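/- Fix a real number $J\ge 4$, an integer $p\ge 1$ and constants $K_\varepsilon,K_u$. Let $N\ge 1$, $T>h\ge 1$ be integers. Let $\{\varepsilon_{it}: 1\le i\le N,\ t\in\mathbb Z\}$ be i.i.d. over both $i$ and $t$ with $E[\varepsilon_{it}]=0$, $E[\varepsilon_{it}^2]=1$ and $(E|\varepsilon_{it}|^J)^{1/J}\le K_\varepsilon$, and put $\boldsymbol\varepsilon_t=(\varepsilon_{1t},\dots,\varepsilon_{Nt})^\top$. Let $\mathbf B_0,\mathbf B_1,\dots$ be real $N\times N$ matrices, let $\boldsymbol\beta_{\ell,j}^\top$ be the $j$-th row of $\mathbf B_\ell$, and assume $$\max_{1\le j\le N}\sum_{\ell=0}^\infty \ell^{\frac{J}{2(J+1)}}\|\boldsymbol\beta_{\ell,j}\|_2^{\frac{J}{J+1}}<\infty .$$ Let $\mathbf x_t=(x_{1t},\dots,x_{Nt})^\top=\sum_{\ell=0}^\infty\mathbf B_\ell\boldsymbol\varepsilon_{t-\ell}$ almost surely for every $t\in\mathbb Z$, and suppose that for some $N\times N$ matrices $\mathbf A_1,\dots,\mathbf A_p$ (which may depend on $h$), for every $t\in\mathbb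 Z$, $$\mathbf x_{t+h}=\mathbf A_1\mathbf x_t+\cdots+\mathbf A_p\mathbf x_{t-p+1}+\mathbf u_{t,h}\quad\text{a.s.},$$ where $\mathbf u_{t,h}=(u_{1t,h},\dots,u_{Nt,h})^\top=\mathbf g(\boldsymbol\varepsilon_{t+h},\dots,\boldsymbol\varepsilon_{t+1})$ a.s. for a measurable function $\mathbf g$ that does not depend on $t$, $E[\mathbf u_{t,h}]=\mathbf 0$, and $(E|u_{it,h}|^J)^{1/J}\le K_u$ for all $i$ and $t$. Define $$\mu_h=\max_{1\le j\le N}\sum_{\ell=0}^\infty\Big[(\ell+h)^{\frac J2-1}\|\boldsymbol\beta_{\ell,j}\|_2^J\Big]^{\frac1{J+1}} .$$ (1) There are positive constants $c_1,c_2,c_3,c_4$ depending only on $J,p,K_\varepsilon,K_u$ (in particular not on $N,T,h,i,j,\ell,\delta$) such that in every such setting, for all $1\le i,j\le N$, all $\ell\in\{0,1,\dots,p-1\}$ and all $\delta>c_4\sqrt T\,\mu_h^{1+1/J}$, $$\Pr\Big(\max_{1\le t\le T-h}\Big|\sum_{s=1}^t u_{is,h}\,x_{j,s-\ell}\Big|\ge\delta\Big)\le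 c_1\frac{T}{\delta^J}\mu_h^{J+1}+c_2\exp\Big(-\frac{c_3\delta^2}{T\mu_h^{2+2/J}}\Big).$$ (2) The series defining $\mu_h$ converge, and $\mu_h\le C\,h^{\frac{J-2}{2(J+1)}}$ for all $h\ge1$, with a constant $C$ depending only on $J$ and on upper bounds for $\max_j\sum_{\ell\ge0}\ell^{\frac{J}{2(J+1)}}\|\boldsymbol\beta_{\ell,j}\|_2^{\frac{J}{J+1}}$ and for $\max_j\|\boldsymbol\beta_{0,j}\|_2$. -/

import Mathlib

open MeasureTheory ProbabilityTheory

noncomputable section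

/-- Innovations: a two-sided sequence of random vectors in `ℝ^N` whose coordinates are i.i.d. over
both the coordinate and the time index, with mean zero, unit variance and a `J`-th absolute moment
(the `L^J` norm is at most `K`). -/
structure IsInnovation {Ω : Type*} [MeasurableSpace Ω] (P : Measure Ω) {N : ℕ} (J K : ℝ)
    (ε : ℤ → Ω → Fin N → ℝ) : Prop where
  measurable : ∀ i t, Measurable (fun ω => ε t ω i)
  indep : iIndepFun (fun (q : Fin N × ℤ) ω => ε q.2 ω q.1) P
  identDistrib : ∀ i t i' t', IdentDistrib (fun ω => ε t ω i) (fun ω => ε t' ω i') P P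
  mean : ∀ i t, ∫ ω, ε t ω i ∂P = 0
  variance : ∀ i t, ∫ ω, (ε t ω i) ^ 2 ∂P = 1
  moment : ∀ i t, eLpNorm (fun ω => ε t ω i) (ENNReal.ofReal J) P ≤ ENNReal.ofReal K

/-- `x` is the moving average of infinite order `x_t = ∑_{ℓ ≥ 0} B_ℓ ε_{t-ℓ}` (almost surely). -/
def IsMovingAverage {Ω : Type*} [MeasurableSpace Ω] (P : Measure Ω) {N : ℕ}
    (B : ℕ → Matrix (Fin N) (Fin N) ℝ) (ε x : ℤ → Ω → Fin N → ℝ) : Prop :=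
  ∀ t : ℤ, ∀ᵐ ω ∂P, HasSum (fun ℓ : ℕ => (B ℓ).mulVec (ε (t - ℓ) ω)) (x t ω)

/-- `u t` is the error `u_{t,h}` of the `h`-step ahead forecasting regression
`x_{t+h} = A_1 x_t + ⋯ + A_p x_{t-p+1} + u_{t,h}` with `p` lags; it has the form
`u_{t,h} = g (ε_{t+h}, …, ε_{t+1})`, mean zero, and `L^J` norms of its entries at most `K`. -/
structure IsForecastError {Ω : Type*} [MeasurableSpace Ω] (P : Measure Ω) {N : ℕ} (J K : ℝ)
    (p h : ℕ) (ε x u : ℤ → Ω → Fin N → ℝ) : Prop where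
  regression : ∃ A : Fin p → Matrix (Fin N) (Fin N) ℝ, ∀ t : ℤ, ∀ᵐ ω ∂P,
    x (t + h) ω = (∑ k : Fin p, (A k).mulVec (x (t - (k : ℕ)) ω)) + u t ω
  future : ∃ g : (Fin h → Fin N → ℝ) → Fin N → ℝ, Measurable g ∧ ∀ t : ℤ, ∀ᵐ ω ∂P,
    u t ω = g (fun k : Fin h => ε (t + h - (k : ℕ)) ω)
  mean : ∀ i t, ∫ ω, u t ω i ∂P = 0
  moment : ∀ i t, eLpNorm (fun ω => u t ω i) (ENNReal.ofReal J) P ≤ ENNReal.ofReal K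

/-- The Euclidean norm of the `j`-th row of a matrix. -/
def rowNorm {N : ℕ} (M : Matrix (Fin N) (Fin N) ℝ) (j : Fin N) : ℝ :=
  Real.sqrt (∑ k, (M j k) ^ 2)

/-- The terms of the weighted series of row norms,
`ℓ^{J/(2(J+1))} ‖β_{ℓ,j}‖₂^{J/(J+1)}`, where `β_{ℓ,j}` is the `j`-th row of `B_ℓ`. -/
def decayTerm {N : ℕ} (J : ℝ) (B : ℕ → Matrix (Fin N) (Fin N) ℝ) (j : Fin N) (ℓ : ℕ) : ℝ :=
  (ℓ : ℝ) ^ (J / (2 * (J + 1))) * rowNorm (B ℓ) j ^ (J / (J + 1))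

/-- The terms `[(ℓ+h)^{J/2-1} ‖β_{ℓ,j}‖₂^J]^{1/(J+1)}` of the series defining `μ_h`. -/
def horizonTerm {N : ℕ} (J : ℝ) (B : ℕ → Matrix (Fin N) (Fin N) ℝ) (h : ℕ) (j : Fin N)
    (ℓ : ℕ) : ℝ :=
  (((ℓ : ℝ) + (h : ℝ)) ^ (J / 2 - 1) * rowNorm (B ℓ) j ^ J) ^ (1 / (J + 1))

/-- The horizon factor `μ_h = max_j ∑_{ℓ ≥ 0} [(ℓ+h)^{J/2-1} ‖β_{ℓ,j}‖₂^J]^{1/(J+1)}`. -/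
def horizonFactor {N : ℕ} (J : ℝ) (B : ℕ → Matrix (Fin N) (Fin N) ℝ) (h : ℕ) : ℝ :=
  ⨆ j : Fin N, ∑' ℓ : ℕ, horizonTerm J B h j ℓ

end

/-!
For fixed `i`, `j` and `ℓ`, write `β_k` for the `j`-th row of `B_k` and expand the process over the
lags of the moving average:
`∑_{s ≤ t} u_{is} x_{j,s-ℓ} = ∑_k M^k_t` with `M^k_t = ∑_{s ≤ t} u_{is} β_k · ε_{s-ℓ-k}`.
The summands of one `M^k` have two properties. They are martingale differences when time is read
*backwards*: `u_{is}` depends on innovations after `s` only, so given everything after `s - ℓ - k`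
it is known, while `β_k · ε_{s-ℓ-k}` is still centred. And they are `m`-dependent with
`m = h + ℓ + k`. Reading time backwards matters: forwards, `u_{is}` is revealed only over the `h`
periods after `s`, so the summands are not martingale differences for the natural filtration.

A Burkholder-type inequality (`IsMartingaleDiff.integral_abs_sum_rpow_le`) and Doob's inequality
bound the `L^J` norm of the sum, and the maximal partial sum, over a block of length `m` by a
multiple of `√m ‖β_k‖`. Every second block is independent of the others, so the Fuk–Nagaev
inequality for independent variables (`measureReal_exists_le_abs_sum_le_of_iIndepFun`, by truncation
and an exponential moment, with Ottaviani's argument for the maximum) applies to the block sums and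
yields, in `IsReverseMartingaleDiff.fukNagaev`,
`P(max_t |M^k_t| ≥ x) ≤ C (T m^{J/2-1} ‖β_k‖^J / x^J + exp(-c x² / (T ‖β_k‖²)))`.

The level `δ` is distributed over the lags in proportion to the terms
`a_k = [(k+h)^{J/2-1} ‖β_k‖^J]^{1/(J+1)}` of the series defining `μ_h`, that is `x = a_k δ / (2 μ_h)`.
With this choice the polynomial term of lag `k` is a multiple of `a_k T μ_h^J / δ^J`, which sums to
`T μ_h^{J+1} / δ^J`, and the Gaussian exponent of lag `k` is at least a multiple of
`√(k+1) δ² / (T μ_h^{2+2/J})`, because `1 - 2/J ≥ 1/2`; the lower bound on `δ` makes the resulting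
series converge to a multiple of the first exponential (`lag_bound_le`).

The bound on `μ_h` compares the series termwise, through `(k+h)^e ≤ (2hk)^e` for `k ≥ 1` and
`(J-2)/(2(J+1)) ≤ J/(2(J+1))`; the term `k = 0` is controlled by `‖β_0‖`.
-/

/-! ### Second-order bounds for `|t| ^ p` and one-step moment inequalities -/

lemma Real.exp_le_one_add_add_sq_mul_exp (s : ℝ) :
    Real.exp s ≤ 1 + s + s ^ 2 * Real.exp |s| := by
  have h := Complex.norm_exp_sub_sum_le_norm_mul_exp (s : ℂ) 2
  have e : Complex.exp (s : ℂ) - ∑ m ∈ Finset.range 2, (s : ℂ) ^ m / (m.factorial : ℂ)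
      = ((Real.exp s - (1 + s) : ℝ) : ℂ) := by
    simp [Finset.sum_range_succ]
  rw [e, Complex.norm_real, Complex.norm_real, Real.norm_eq_abs, Real.norm_eq_abs, sq_abs] at h
  linarith [le_abs_self (Real.exp s - (1 + s))]

/-- The constant in the second-order bound `abs_add_rpow_le` for `t ↦ |t| ^ p`. -/
noncomputable def taylorConst (p : ℝ) : ℝ := 2 ^ p + p + p ^ 2 * Real.exp p

lemma one_le_taylorConst {p : ℝ} (hp : 2 ≤ p) : 1 ≤ taylorConst p := by
  have h1 : (1 : ℝ) ≤ 2 ^ p := Real.one_le_rpow (by norm_num) (by linarith)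
  have h2 : 0 ≤ p ^ 2 * Real.exp p := by positivity
  unfold taylorConst; linarith

lemma abs_add_rpow_le {p : ℝ} (hp : 2 ≤ p) (a b : ℝ) :
    |a + b| ^ p ≤ |a| ^ p + p * (|a| ^ (p - 2) * a * b)
      + taylorConst p * (|a| ^ (p - 2) * b ^ 2 + |b| ^ p) := by
  have hA : 0 ≤ |a| ^ (p - 2) := by positivity
  have hB : 0 ≤ |b| ^ p := by positivity
  have h2p : (0 : ℝ) ≤ 2 ^ p := by positivity
  have hE : 0 ≤ p ^ 2 * Real.exp p := by positivity
  rcases lt_or_ge |a| |b| with hab | hab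
  -- for `|a| < |b|` every term is of order `|b| ^ p`; otherwise `1 + b / a ≤ exp (b / a)`
  · have hb : 0 < |b| := (abs_nonneg a).trans_lt hab
    have h1 : |a + b| ^ p ≤ 2 ^ p * |b| ^ p := by
      rw [← Real.mul_rpow (by norm_num) hb.le]
      exact Real.rpow_le_rpow (abs_nonneg _) (by linarith [abs_add_le a b]) (by linarith)
    have h2 : |(|a| ^ (p - 2) * a * b)| ≤ |b| ^ p := by
      rw [abs_mul, abs_mul, abs_of_nonneg hA]
      have e : |b| ^ p = |b| ^ (p - 2) * |b| * |b| := by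
        rw [mul_assoc, ← sq, ← Real.rpow_natCast, ← Real.rpow_add hb]; norm_num
      rw [e]
      have : |a| ^ (p - 2) ≤ |b| ^ (p - 2) :=
        Real.rpow_le_rpow (abs_nonneg _) hab.le (by linarith)
      gcongr
    have h3 := neg_abs_le (|a| ^ (p - 2) * a * b)
    have h4 : 0 ≤ |a| ^ p := by positivity
    have h5 : 0 ≤ taylorConst p * (|a| ^ (p - 2) * b ^ 2) := by
      have := one_le_taylorConst hp; positivity
    have h6 : p * (-|b| ^ p) ≤ p * (|a| ^ (p - 2) * a * b) := by
      gcongr; linarith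
    unfold taylorConst at *
    nlinarith
  · rcases eq_or_ne a 0 with rfl | ha
    · have : b = 0 := by simpa using hab
      subst this
      simp [Real.zero_rpow (by linarith : p ≠ 0)]
    have ha' : 0 < |a| := abs_pos.2 ha
    set z := b / a with hz
    have hb : b = a * z := by rw [hz]; field_simp
    have hz1 : |z| ≤ 1 := by rw [hz, abs_div]; exact (div_le_one ha').2 hab
    have hz0 : 0 ≤ 1 + z := by linarith [neg_abs_le z]
    have e1 : |a + b| ^ p = |a| ^ p * (1 + z) ^ p := by
      rw [hb, show a + a * z = a * (1 + z) by ring, abs_mul, abs_of_nonneg hz0,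
        Real.mul_rpow (abs_nonneg _) hz0]
    have e2 : |a| ^ (p - 2) * a ^ 2 = |a| ^ p := by
      rw [← sq_abs, ← Real.rpow_natCast, ← Real.rpow_add ha']; norm_num
    have e3 : |a| ^ (p - 2) * a * b = |a| ^ p * z := by rw [hb, ← e2]; ring
    have e4 : |a| ^ (p - 2) * b ^ 2 = |a| ^ p * z ^ 2 := by rw [hb, ← e2]; ring
    have key : (1 + z) ^ p ≤ 1 + p * z + p ^ 2 * Real.exp p * z ^ 2 := by
      calc (1 + z) ^ p ≤ (Real.exp z) ^ p :=
            Real.rpow_le_rpow hz0 (by linarith [Real.add_one_le_exp z]) (by linarith)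
        _ = Real.exp (p * z) := by rw [← Real.exp_mul, mul_comm]
        _ ≤ 1 + p * z + (p * z) ^ 2 * Real.exp |p * z| := Real.exp_le_one_add_add_sq_mul_exp _
        _ ≤ 1 + p * z + (p * z) ^ 2 * Real.exp p := by
            gcongr
            rw [abs_mul, abs_of_nonneg (by linarith : 0 ≤ p)]
            exact mul_le_of_le_one_right (by linarith) hz1
        _ = _ := by ring
    have hX : 0 ≤ |a| ^ p := by positivity
    have := mul_le_mul_of_nonneg_left key hX
    rw [e1, e3, e4]
    have h7 : 0 ≤ (2 ^ p + p) * (|a| ^ p * z ^ 2 + |b| ^ p) := by positivity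
    have h8 : 0 ≤ p ^ 2 * Real.exp p * |b| ^ p := by positivity
    unfold taylorConst
    nlinarith

lemma abs_rpow_mul_sq_le {p : ℝ} (hp : 2 ≤ p) (a b : ℝ) :
    |a| ^ (p - 2) * b ^ 2 ≤ |a| ^ p + |b| ^ p := by
  have e : ∀ x y : ℝ, |x| ≤ |y| → |x| ^ (p - 2) * |y| ^ 2 ≤ |y| ^ p := by
    intro x y hxy
    rcases (abs_nonneg y).eq_or_lt with h | h
    · rw [← h]; simp; positivity
    · rw [show |y| ^ p = |y| ^ (p - 2) * |y| ^ 2 by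
        rw [← Real.rpow_natCast, ← Real.rpow_add h]; norm_num]
      gcongr
  have ha : 0 ≤ |a| ^ p := by positivity
  have hb : 0 ≤ |b| ^ p := by positivity
  rw [← sq_abs b]
  rcases le_total |a| |b| with h | h
  · linarith [e a b h]
  · have := e a a le_rfl
    have h3 : |a| ^ (p - 2) * |b| ^ 2 ≤ |a| ^ (p - 2) * |a| ^ 2 := by gcongr
    linarith

lemma abs_abs_rpow_mul_mul_le {p : ℝ} (hp : 2 ≤ p) (a b : ℝ) :
    |(|a| ^ (p - 2) * a * b)| ≤ |a| ^ p + |b| ^ p := by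
  have h0 : 0 ≤ |a| ^ (p - 2) := by positivity
  have h : |a| * |b| ≤ (a ^ 2 + b ^ 2) / 2 := by
    nlinarith [sq_nonneg (|a| - |b|), sq_abs a, sq_abs b]
  have h1 := abs_rpow_mul_sq_le hp a b
  have h2 : |a| ^ (p - 2) * a ^ 2 ≤ |a| ^ p := by
    rcases eq_or_ne a 0 with rfl | h
    · simp only [ne_eq, OfNat.ofNat_ne_zero, not_false_eq_true, zero_pow, mul_zero]; positivity
    · rw [← sq_abs a, ← Real.rpow_natCast, ← Real.rpow_add (abs_pos.2 h)]; norm_num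
  rw [abs_mul, abs_mul, abs_of_nonneg h0, mul_assoc]
  have h3 := mul_le_mul_of_nonneg_left h h0
  have hb : 0 ≤ |b| ^ p := by positivity
  have ha : 0 ≤ |a| ^ p := by positivity
  nlinarith

section Moments

variable {Ω : Type*} {mΩ : MeasurableSpace Ω} {P : Measure Ω}

lemma MeasureTheory.MemLp.integrable_abs_rpow {p : ℝ} (hp : 0 < p) {f : Ω → ℝ}
    (hf : MemLp f (ENNReal.ofReal p) P) : Integrable (fun ω => |f ω| ^ p) P := by
  have := hf.integrable_norm_rpow (by simpa using hp) ENNReal.ofReal_ne_top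
  simpa [ENNReal.toReal_ofReal hp.le] using this

lemma integrable_abs_rpow_mul_sq {p : ℝ} (hp : 2 ≤ p) {a b : Ω → ℝ}
    (ha : MemLp a (ENNReal.ofReal p) P) (hb : MemLp b (ENNReal.ofReal p) P) :
    Integrable (fun ω => |a ω| ^ (p - 2) * b ω ^ 2) P := by
  have h0 : 0 < p := by linarith
  refine ((ha.integrable_abs_rpow h0).add (hb.integrable_abs_rpow h0)).mono' ?_
    (.of_forall fun ω => ?_)
  · have := ha.1.aemeasurable; have := hb.1.aemeasurable
    exact AEMeasurable.aestronglyMeasurable (by fun_prop)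
  · rw [Real.norm_of_nonneg (by positivity)]
    exact abs_rpow_mul_sq_le hp _ _

lemma integrable_abs_rpow_mul_mul {p : ℝ} (hp : 2 ≤ p) {a b : Ω → ℝ}
    (ha : MemLp a (ENNReal.ofReal p) P) (hb : MemLp b (ENNReal.ofReal p) P) :
    Integrable (fun ω => |a ω| ^ (p - 2) * a ω * b ω) P := by
  have h0 : 0 < p := by linarith
  refine ((ha.integrable_abs_rpow h0).add (hb.integrable_abs_rpow h0)).mono' ?_
    (.of_forall fun ω => ?_)
  · have := ha.1.aemeasurable; have := hb.1.aemeasurable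
    exact AEMeasurable.aestronglyMeasurable (by fun_prop)
  · exact abs_abs_rpow_mul_mul_le hp _ _

/-- Hölder's inequality with exponents `p / (p - 2)` and `p / 2`, where `V` and `v` bound the
squared `L^p` norms of the two functions. -/
lemma integral_abs_rpow_mul_sq_le {p : ℝ} (hp : 2 ≤ p) {a b : Ω → ℝ} {V v : ℝ}
    (hV : 0 ≤ V) (hv : 0 ≤ v)
    (ha : MemLp a (ENNReal.ofReal p) P) (hb : MemLp b (ENNReal.ofReal p) P)
    (hVa : ∫ ω, |a ω| ^ p ∂P ≤ V ^ (p / 2)) (hvb : ∫ ω, |b ω| ^ p ∂P ≤ v ^ (p / 2)) :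
    ∫ ω, |a ω| ^ (p - 2) * b ω ^ 2 ∂P ≤ V ^ (p / 2 - 1) * v := by
  have h0 : 0 < p := by linarith
  have hae := ha.1.aemeasurable
  have hbe := hb.1.aemeasurable
  have key := ENNReal.lintegral_mul_norm_pow_le (μ := P)
    (f := fun ω => ENNReal.ofReal (|a ω| ^ p)) (g := fun ω => ENNReal.ofReal (|b ω| ^ p))
    (by fun_prop) (by fun_prop) (p := (p - 2) / p) (q := 2 / p)
    (div_nonneg (by linarith) h0.le) (by positivity) (by field_simp; ring)
  rw [← ofReal_integral_eq_lintegral_ofReal (ha.integrable_abs_rpow h0)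
      (.of_forall fun ω => by positivity),
    ← ofReal_integral_eq_lintegral_ofReal (hb.integrable_abs_rpow h0)
      (.of_forall fun ω => by positivity)] at key
  have e : ∀ ω, ENNReal.ofReal (|a ω| ^ p) ^ ((p - 2) / p) * ENNReal.ofReal (|b ω| ^ p) ^ (2 / p)
      = ENNReal.ofReal (|a ω| ^ (p - 2) * b ω ^ 2) := by
    intro ω
    rw [ENNReal.ofReal_rpow_of_nonneg (by positivity) (div_nonneg (by linarith) h0.le),
      ENNReal.ofReal_rpow_of_nonneg (by positivity) (by positivity),
      ← ENNReal.ofReal_mul (by positivity), ← Real.rpow_mul (abs_nonneg _),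
      ← Real.rpow_mul (abs_nonneg _), mul_div_cancel₀ _ h0.ne', mul_div_cancel₀ _ h0.ne',
      Real.rpow_two, sq_abs]
  simp_rw [e] at key
  rw [← ofReal_integral_eq_lintegral_ofReal (integrable_abs_rpow_mul_sq hp ha hb)
      (.of_forall fun ω => by positivity)] at key
  have hA : 0 ≤ ∫ ω, |a ω| ^ p ∂P := integral_nonneg fun ω => by positivity
  have hB : 0 ≤ ∫ ω, |b ω| ^ p ∂P := integral_nonneg fun ω => by positivity
  rw [ENNReal.ofReal_rpow_of_nonneg hA (div_nonneg (by linarith) h0.le),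
    ENNReal.ofReal_rpow_of_nonneg hB (by positivity), ← ENNReal.ofReal_mul (by positivity),
    ENNReal.ofReal_le_ofReal_iff (by positivity)] at key
  refine key.trans ?_
  have hVe : V ^ (p / 2 - 1) = (V ^ (p / 2)) ^ ((p - 2) / p) := by
    rw [← Real.rpow_mul hV]; congr 1; field_simp
  have hve : v = (v ^ (p / 2)) ^ (2 / p) := by
    rw [← Real.rpow_mul hv, show p / 2 * (2 / p) = 1 by field_simp, Real.rpow_one]
  rw [hVe]
  conv_rhs => rw [hve]
  gcongr

/-- The constant in the moment bounds for sums of orthogonal increments: the squared `L^p` norm of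
the sum is at most this constant times the sum of the squared `L^p` norms. -/
noncomputable def momentConst (p : ℝ) : ℝ := 2 * taylorConst p

lemma momentConst_pos {p : ℝ} (hp : 2 ≤ p) : 0 < momentConst p := by
  have := one_le_taylorConst hp; unfold momentConst; positivity

lemma rpow_add_le_of_momentConst {p : ℝ} (hp : 2 ≤ p) {V v : ℝ} (hV : 0 ≤ V) (hv : 0 ≤ v) :
    (momentConst p * V) ^ (p / 2)
      + taylorConst p * ((momentConst p * V) ^ (p / 2 - 1) * v + v ^ (p / 2))
      ≤ (momentConst p * (V + v)) ^ (p / 2) := by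
  have hK := one_le_taylorConst hp
  set C := momentConst p with hC
  have hCK : C = 2 * taylorConst p := rfl
  have hC1 : 1 ≤ C := by linarith
  have hsplit : ∀ x : ℝ, 0 ≤ x → x ^ (p / 2) = x ^ (p / 2 - 1) * x := by
    intro x hx
    rcases hx.eq_or_lt with rfl | hx
    · rw [Real.zero_rpow (by linarith : p / 2 ≠ 0)]; simp
    · rw [← Real.rpow_add_one hx.ne']; norm_num
  have hX : 0 ≤ C * V := by positivity
  have hY : 0 ≤ C * v := by positivity
  have h1 : (C * V) ^ (p / 2 - 1) ≤ (C * V + C * v) ^ (p / 2 - 1) :=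
    Real.rpow_le_rpow hX (by linarith) (by linarith)
  have h2 : v ^ (p / 2 - 1) ≤ (C * V + C * v) ^ (p / 2 - 1) :=
    Real.rpow_le_rpow hv (by nlinarith) (by linarith)
  rw [mul_add C, hsplit _ hX, hsplit _ hv, hsplit _ (add_nonneg hX hY)]
  have h3 := mul_le_mul_of_nonneg_right h1 hX
  have h4 : taylorConst p * ((C * V) ^ (p / 2 - 1) * v + v ^ (p / 2 - 1) * v)
      ≤ taylorConst p * ((C * V + C * v) ^ (p / 2 - 1) * v
        + (C * V + C * v) ^ (p / 2 - 1) * v) := by gcongr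
  have h5 : taylorConst p * ((C * V + C * v) ^ (p / 2 - 1) * v
        + (C * V + C * v) ^ (p / 2 - 1) * v) = (C * V + C * v) ^ (p / 2 - 1) * (C * v) := by
    rw [hCK]; ring
  linarith

/-- If `b` is orthogonal to the derivative of `|a| ^ p`, then squared `L^p` norms add up, up to the
factor `momentConst p`. This is the induction step of the moment inequalities for sums. -/
lemma integral_abs_add_rpow_le {p : ℝ} (hp : 2 ≤ p) {a b : Ω → ℝ} {V v : ℝ}
    (hV : 0 ≤ V) (hv : 0 ≤ v)
    (ha : MemLp a (ENNReal.ofReal p) P) (hb : MemLp b (ENNReal.ofReal p) P)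
    (hVa : ∫ ω, |a ω| ^ p ∂P ≤ (momentConst p * V) ^ (p / 2))
    (hvb : ∫ ω, |b ω| ^ p ∂P ≤ v ^ (p / 2))
    (horth : ∫ ω, |a ω| ^ (p - 2) * a ω * b ω ∂P = 0) :
    ∫ ω, |a ω + b ω| ^ p ∂P ≤ (momentConst p * (V + v)) ^ (p / 2) := by
  have h0 : 0 < p := by linarith
  have hC := momentConst_pos hp
  have hK := one_le_taylorConst hp
  have i1 := ha.integrable_abs_rpow h0
  have i2 := (integrable_abs_rpow_mul_mul hp ha hb).const_mul p
  have i3 := integrable_abs_rpow_mul_sq hp ha hb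
  have i4 := hb.integrable_abs_rpow h0
  have i5 : Integrable (fun ω => |a ω| ^ p + p * (|a ω| ^ (p - 2) * a ω * b ω)) P := i1.add i2
  have i6 : Integrable (fun ω => taylorConst p * (|a ω| ^ (p - 2) * b ω ^ 2 + |b ω| ^ p)) P :=
    (i3.add i4).const_mul _
  have h := integral_mono ((ha.add hb).integrable_abs_rpow h0)
    (i5.add i6)
    (fun ω => abs_add_rpow_le hp (a ω) (b ω))
  simp only [Pi.add_apply] at h
  rw [integral_add i5 i6, integral_add i1 i2,
    integral_const_mul, integral_const_mul, integral_add i3 i4, horth] at h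
  refine h.trans (le_trans ?_ (rpow_add_le_of_momentConst hp hV hv))
  have h5 := integral_abs_rpow_mul_sq_le hp (by positivity) hv ha hb hVa hvb
  have : taylorConst p * ((∫ ω, |a ω| ^ (p - 2) * b ω ^ 2 ∂P) + ∫ ω, |b ω| ^ p ∂P)
      ≤ taylorConst p * ((momentConst p * V) ^ (p / 2 - 1) * v + v ^ (p / 2)) := by gcongr
  linarith

end Moments

/-! ### Moments of sums and maximal inequalities for martingale differences -/

section IndependentSums

variable {Ω : Type*} {mΩ : MeasurableSpace Ω} {P : Measure Ω}

lemma memLp_sum_and_integral_abs_sum_rpow_le_of_iIndepFun [IsProbabilityMeasure P] {ι : Type*}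
    {p : ℝ} (hp : 2 ≤ p) {X : ι → Ω → ℝ} {v : ι → ℝ} (hX : ∀ i, Measurable (X i))
    (hind : iIndepFun X P) (hmean : ∀ i, ∫ ω, X i ω ∂P = 0) (hv : ∀ i, 0 ≤ v i)
    (hLp : ∀ i, MemLp (X i) (ENNReal.ofReal p) P)
    (hmom : ∀ i, ∫ ω, |X i ω| ^ p ∂P ≤ v i ^ (p / 2)) (s : Finset ι) :
    MemLp (fun ω => ∑ i ∈ s, X i ω) (ENNReal.ofReal p) P ∧
      ∫ ω, |∑ i ∈ s, X i ω| ^ p ∂P ≤ (momentConst p * ∑ i ∈ s, v i) ^ (p / 2) := by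
  classical
  refine ⟨memLp_finsetSum _ fun i _ => hLp i, ?_⟩
  induction s using Finset.induction_on with
  | empty =>
    simp [Real.zero_rpow (by linarith : p ≠ 0), Real.zero_rpow (by linarith : p / 2 ≠ 0)]
  | insert i s hi ih =>
    simp_rw [Finset.sum_insert hi, add_comm (X i _), add_comm (v i)]
    refine integral_abs_add_rpow_le hp (Finset.sum_nonneg fun i _ => hv i) (hv i)
      (memLp_finsetSum _ fun i _ => hLp i) (hLp i) ih (hmom i) ?_
    have h1 : IndepFun (∑ j ∈ s, X j) (X i) P := hind.indepFun_finsetSum_of_notMem hX hi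
    have h2 : IndepFun (fun ω => |∑ j ∈ s, X j ω| ^ (p - 2) * ∑ j ∈ s, X j ω) (X i) P := by
      have h3 := h1.comp (φ := fun x : ℝ => |x| ^ (p - 2) * x) (ψ := id) (by fun_prop)
        measurable_id
      simpa [Function.comp_def] using h3
    have hm : Measurable (fun ω => |∑ j ∈ s, X j ω| ^ (p - 2) * ∑ j ∈ s, X j ω) := by fun_prop
    rw [h2.integral_fun_mul_eq_mul_integral hm.aestronglyMeasurable
      (hX i).aestronglyMeasurable, hmean i, mul_zero]

end IndependentSums

section MartingaleDifferences

variable {Ω : Type*} {mΩ : MeasurableSpace Ω} {P : Measure Ω}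

/-- A sequence of martingale differences: `d q` is known at time `q + 1` and has conditional mean
zero given the information available at time `q`. -/
structure IsMartingaleDiff (d : ℕ → Ω → ℝ) (𝓖 : Filtration ℕ mΩ) (P : Measure Ω) : Prop where
  adapted : ∀ q, StronglyMeasurable[𝓖 (q + 1)] (d q)
  condExp : ∀ q, P[d q | 𝓖 q] =ᵐ[P] 0

lemma IsMartingaleDiff.stronglyMeasurable_sum {d : ℕ → Ω → ℝ} {𝓖 : Filtration ℕ mΩ}
    (hd : IsMartingaleDiff d 𝓖 P) (n : ℕ) :
    StronglyMeasurable[𝓖 n] (fun ω => ∑ q ∈ Finset.range n, d q ω) :=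
  Finset.stronglyMeasurable_fun_sum _ fun q hq =>
    (hd.adapted q).mono (𝓖.mono (Finset.mem_range.1 hq))

variable [IsProbabilityMeasure P]

lemma integral_mul_eq_zero_of_condExp_eq_zero {m : MeasurableSpace Ω} (hm : m ≤ mΩ)
    {f g : Ω → ℝ} (hf : StronglyMeasurable[m] f) (hfg : Integrable (fun ω => f ω * g ω) P)
    (hg : Integrable g P) (h : P[g | m] =ᵐ[P] 0) : ∫ ω, f ω * g ω ∂P = 0 := by
  rw [← integral_condExp hm]
  have h1 : P[fun ω => f ω * g ω | m] =ᵐ[P] f * P[g | m] :=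
    condExp_mul_of_stronglyMeasurable_left hf hfg hg
  rw [integral_congr_ae (h1.trans (h.mono fun ω hω => by
    rw [Pi.mul_apply, hω]; simp : f * P[g | m] =ᵐ[P] fun _ => (0 : ℝ)))]
  simp

/-- A Burkholder-type inequality: the squared `L^p` norm of a martingale grows at most linearly in
the number of steps. -/
lemma IsMartingaleDiff.integral_abs_sum_rpow_le {p : ℝ} (hp : 2 ≤ p) {d : ℕ → Ω → ℝ}
    {𝓖 : Filtration ℕ mΩ} (hd : IsMartingaleDiff d 𝓖 P) {v : ℝ} (hv : 0 ≤ v)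
    (hLp : ∀ q, MemLp (d q) (ENNReal.ofReal p) P)
    (hmom : ∀ q, ∫ ω, |d q ω| ^ p ∂P ≤ v ^ (p / 2)) (n : ℕ) :
    ∫ ω, |∑ q ∈ Finset.range n, d q ω| ^ p ∂P ≤ (momentConst p * (n * v)) ^ (p / 2) := by
  induction n with
  | zero =>
    simp [Real.zero_rpow (by linarith : p ≠ 0), Real.zero_rpow (by linarith : p / 2 ≠ 0)]
  | succ n ih =>
    have hS : MemLp (fun ω => ∑ q ∈ Finset.range n, d q ω) (ENNReal.ofReal p) P :=
      memLp_finsetSum _ fun i _ => hLp i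
    simp_rw [Finset.sum_range_succ]
    rw [show ((n + 1 : ℕ) : ℝ) * v = n * v + v by push_cast; ring]
    refine integral_abs_add_rpow_le hp (by positivity) hv hS (hLp n) ih (hmom n) ?_
    have hs := hd.stronglyMeasurable_sum n
    have hs' : StronglyMeasurable[𝓖 n] (fun ω => |∑ q ∈ Finset.range n, d q ω| ^ (p - 2)
        * ∑ q ∈ Finset.range n, d q ω) := by
      have := hs.measurable
      exact Measurable.stronglyMeasurable (by fun_prop)
    exact integral_mul_eq_zero_of_condExp_eq_zero (𝓖.le n) hs'
      (integrable_abs_rpow_mul_mul hp hS (hLp n))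
      ((hLp n).integrable (by rw [ENNReal.one_le_ofReal]; linarith)) (hd.condExp n)

lemma IsMartingaleDiff.condExp_sum {d : ℕ → Ω → ℝ} {𝓖 : Filtration ℕ mΩ}
    (hd : IsMartingaleDiff d 𝓖 P) (hint : ∀ q, Integrable (d q) P) {k n : ℕ} (hkn : k ≤ n) :
    P[fun ω => ∑ q ∈ Finset.range n, d q ω | 𝓖 k] =ᵐ[P] fun ω => ∑ q ∈ Finset.range k, d q ω := by
  induction n, hkn using Nat.le_induction with
  | base =>
    rw [condExp_of_stronglyMeasurable (𝓖.le k) (hd.stronglyMeasurable_sum k)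
      (integrable_finsetSum _ fun i _ => hint i)]
  | succ n hkn ih =>
    have h0 : P[d n | 𝓖 k] =ᵐ[P] 0 := by
      have h1 := condExp_condExp_of_le (μ := P) (f := d n) (𝓖.mono hkn) (𝓖.le n)
      have h2 := condExp_congr_ae (m := 𝓖 k) (hd.condExp n)
      rw [condExp_zero] at h2
      exact h1.symm.trans h2
    have h1 : P[fun ω => ∑ q ∈ Finset.range (n + 1), d q ω | 𝓖 k] =ᵐ[P]
        P[fun ω => ∑ q ∈ Finset.range n, d q ω | 𝓖 k] + P[d n | 𝓖 k] := by
      simp_rw [Finset.sum_range_succ]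
      exact condExp_add (integrable_finsetSum _ fun i _ => hint i) (hint n) _
    filter_upwards [h1, ih, h0] with ω e1 e2 e3
    rw [e1, Pi.add_apply, e2, e3]; simp

/-- First-passage decomposition: if `A 0, A 1, …` is adapted and, up to time `n`, the measure of
every event `B ⊆ A k` known at time `k` is at most the integral of `f` over `B`, then the measure of
`⋃ k ≤ n, A k` is at most the integral of `f`. -/
lemma measureReal_exists_le_of_forall_subset {𝓖 : Filtration ℕ mΩ} {A : ℕ → Set Ω}
    (hA : ∀ k, MeasurableSet[𝓖 k] (A k)) {f : Ω → ℝ} (hf : Integrable f P) (hf0 : ∀ ω, 0 ≤ f ω)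
    {n : ℕ} (h : ∀ k ≤ n, ∀ B, MeasurableSet[𝓖 k] B → B ⊆ A k → P.real B ≤ ∫ ω in B, f ω ∂P) :
    P.real {ω | ∃ k ≤ n, ω ∈ A k} ≤ ∫ ω, f ω ∂P := by
  set D := disjointed A
  have hD : ∀ k, MeasurableSet[𝓖 k] (D k) := by
    intro k
    rw [show D k = A k \ ⋃ j ∈ Finset.Iio k, A j by simp [D, disjointed]]
    exact (hA k).diff (Finset.measurableSet_biUnion _ fun j hj =>
      𝓖.mono (Finset.mem_Iio.1 hj).le _ (hA j))
  have hD' : ∀ k, MeasurableSet (D k) := fun k => 𝓖.le k _ (hD k)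
  have hdis : Pairwise (Function.onFun Disjoint D) := disjoint_disjointed A
  have hU : {ω | ∃ k ≤ n, ω ∈ A k} ⊆ ⋃ k ∈ Finset.range (n + 1), D k := by
    rintro ω ⟨k, hk, hω⟩
    have h1 : ω ∈ ⋃ j ∈ Finset.range (n + 1), A j := by
      simp only [Set.mem_iUnion, Finset.mem_range]; exact ⟨k, by omega, hω⟩
    classical
    have hex : ∃ k, ω ∈ A k := ⟨k, hω⟩
    simp only [Set.mem_iUnion, Finset.mem_range]
    refine ⟨Nat.find hex, by have := Nat.find_min' hex hω; omega, ?_⟩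
    rw [show D (Nat.find hex) = A (Nat.find hex) \ ⋃ j ∈ Finset.Iio (Nat.find hex), A j by
      simp [D, disjointed]]
    refine ⟨Nat.find_spec hex, ?_⟩
    simp only [Set.mem_iUnion, Finset.mem_Iio, not_exists]
    exact fun j hj => Nat.find_min hex hj
  calc P.real {ω | ∃ k ≤ n, ω ∈ A k} ≤ P.real (⋃ k ∈ Finset.range (n + 1), D k) :=
        measureReal_mono hU (measure_ne_top _ _)
    _ ≤ ∑ k ∈ Finset.range (n + 1), P.real (D k) := measureReal_biUnion_finset_le _ _
    _ ≤ ∑ k ∈ Finset.range (n + 1), ∫ ω in D k, f ω ∂P :=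
        Finset.sum_le_sum fun k hk => h k (by have := Finset.mem_range.1 hk; omega) _ (hD k)
          (disjointed_subset A k)
    _ = ∫ ω in ⋃ k ∈ Finset.range (n + 1), D k, f ω ∂P :=
        (integral_biUnion_finset _ (fun k _ => hD' k) (fun i _ j _ hij => hdis hij)
          fun k _ => hf.integrableOn).symm
    _ ≤ ∫ ω, f ω ∂P := setIntegral_le_integral hf (.of_forall hf0)

/-- Doob's maximal inequality for the submartingale `|M| ^ p`. -/
lemma IsMartingaleDiff.measureReal_exists_le_abs_sum {p : ℝ} (hp : 2 ≤ p) {d : ℕ → Ω → ℝ}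
    {𝓖 : Filtration ℕ mΩ} (hd : IsMartingaleDiff d 𝓖 P)
    (hLp : ∀ q, MemLp (d q) (ENNReal.ofReal p) P) {x : ℝ} (hx : 0 < x) (n : ℕ) :
    P.real {ω | ∃ k ≤ n, x ≤ |∑ q ∈ Finset.range k, d q ω|} ≤
      (∫ ω, |∑ q ∈ Finset.range n, d q ω| ^ p ∂P) / x ^ p := by
  have hp0 : 0 < p := by linarith
  have hint : ∀ q, Integrable (d q) P := fun q =>
    (hLp q).integrable (by rw [ENNReal.one_le_ofReal]; linarith)
  have hS : ∀ k, MemLp (fun ω => ∑ q ∈ Finset.range k, d q ω) (ENNReal.ofReal p) P :=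
    fun k => memLp_finsetSum _ fun i _ => hLp i
  have hI := fun k => (hS k).integrable_abs_rpow hp0
  rw [← integral_div]
  refine measureReal_exists_le_of_forall_subset (𝓖 := 𝓖)
    (A := fun k => {ω | x ≤ |∑ q ∈ Finset.range k, d q ω|}) (fun k => ?_) ((hI n).div_const _)
    (fun ω => by positivity) (fun k hk B hB hBA => ?_)
  · have := (hd.stronglyMeasurable_sum k).measurable
    exact measurableSet_le measurable_const (by fun_prop)
  have hcvx : ConvexOn ℝ Set.univ (fun t : ℝ => |t| ^ p) := by
    have h1 : ConvexOn ℝ (Set.Ici 0) (fun t : ℝ => t ^ p) := convexOn_rpow (by linarith)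
    refine ⟨convex_univ, fun y _ z _ a b ha hb hab => ?_⟩
    calc |a • y + b • z| ^ p ≤ (a • |y| + b • |z|) ^ p := by
          refine Real.rpow_le_rpow (abs_nonneg _) ?_ hp0.le
          refine (abs_add_le _ _).trans ?_
          simp [abs_mul, abs_of_nonneg ha, abs_of_nonneg hb]
      _ ≤ _ := h1.2 (abs_nonneg y) (abs_nonneg z) ha hb hab
  have hjen := hcvx.map_condExp_le (μ := P) (𝓖.le k) (f := fun ω => ∑ q ∈ Finset.range n, d q ω)
    ((Continuous.lowerSemicontinuous (by
      exact (continuous_abs.rpow_const fun _ => Or.inr hp0.le))).lowerSemicontinuousOn _)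
    (by simp) isClosed_univ (integrable_finsetSum _ fun i _ => hint i) (hI n)
  have hmain : ∫ ω in B, |∑ q ∈ Finset.range k, d q ω| ^ p ∂P
      ≤ ∫ ω in B, |∑ q ∈ Finset.range n, d q ω| ^ p ∂P := by
    rw [← setIntegral_condExp (𝓖.le k) (hI n) hB]
    refine setIntegral_mono_ae (hI k).integrableOn integrable_condExp.integrableOn ?_
    filter_upwards [hjen, hd.condExp_sum hint hk] with ω h1 h2
    simpa [h2, Function.comp_def] using h1
  rw [integral_div, le_div_iff₀ (by positivity)]
  refine le_trans ?_ hmain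
  have hc : ∫ ω in B, x ^ p ∂P = P.real B * x ^ p := by
    rw [setIntegral_const, smul_eq_mul]
  rw [← hc]
  refine setIntegral_mono_on (integrable_const _).integrableOn (hI k).integrableOn (𝓖.le k _ hB) ?_
  intro ω hω
  exact Real.rpow_le_rpow hx.le (hBA hω) hp0.le

end MartingaleDifferences

/-! ### The Fuk–Nagaev inequality for independent variables -/

lemma Real.exp_le_one_add_add_sq_mul_exp_of_le {s p : ℝ} (hp : 1 ≤ p) (hs : s ≤ p) :
    Real.exp s ≤ 1 + s + s ^ 2 * Real.exp p := by
  have h1 : 1 ≤ Real.exp p := Real.one_le_exp (by linarith)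
  rcases lt_or_ge s (-1) with h | h
  · have : Real.exp s ≤ 1 := Real.exp_le_one_iff.2 (by linarith)
    nlinarith [mul_le_mul_of_nonneg_left h1 (sq_nonneg s)]
  · refine (Real.exp_le_one_add_add_sq_mul_exp s).trans ?_
    gcongr
    exact abs_le.2 ⟨by linarith, hs⟩

/-- The pointwise bound behind the exponential moment of the truncated variable `min w y`: a
quadratic term for moderate values and a `p`-th power for large ones. -/
lemma exp_mul_min_le {p : ℝ} (hp : 2 ≤ p) {r y : ℝ} (hr : 0 < r) (hy : 0 < y) (w : ℝ) :
    Real.exp (r * min w y) ≤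
      1 + r * w + Real.exp p * r ^ 2 * w ^ 2 + Real.exp (r * y) / y ^ p * |w| ^ p := by
  set t := min w y with ht
  have htw : t ≤ w := min_le_left _ _
  have hty : t ≤ y := min_le_right _ _
  have hsq : t ^ 2 ≤ w ^ 2 := by
    rcases min_choice w y with h | h
    · rw [ht, h]
    · have : t = y := h
      rw [sq_le_sq₀ (by linarith) (by linarith)]; exact htw
  have hlast : 0 ≤ Real.exp (r * y) / y ^ p * |w| ^ p := by positivity
  rcases le_or_gt (r * t) p with h | h
  · have h1 := Real.exp_le_one_add_add_sq_mul_exp_of_le (by linarith) h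
    have h2 : (r * t) ^ 2 * Real.exp p ≤ Real.exp p * r ^ 2 * w ^ 2 := by
      rw [mul_pow, mul_comm, mul_assoc]; gcongr
    have h3 : r * t ≤ r * w := by gcongr
    linarith
  · have ht0 : 0 < t := pos_of_mul_pos_right (by linarith : 0 < r * t) hr.le
    have h1 : (y / t) ^ p ≤ Real.exp (r * y - r * t) := by
      calc (y / t) ^ p ≤ (Real.exp (y / t - 1)) ^ p := by
            refine Real.rpow_le_rpow (by positivity) ?_ (by linarith)
            linarith [Real.add_one_le_exp (y / t - 1)]
        _ = Real.exp (p * ((y - t) / t)) := by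
            rw [← Real.exp_mul, mul_comm]; congr 2; field_simp
        _ ≤ Real.exp (r * t * ((y - t) / t)) := by
            have : 0 ≤ (y - t) / t := div_nonneg (by linarith) ht0.le
            gcongr
        _ = Real.exp (r * y - r * t) := by congr 1; field_simp
    have h2 : Real.exp (r * t) ≤ Real.exp (r * y) / y ^ p * |w| ^ p := by
      rw [Real.div_rpow hy.le ht0.le, Real.exp_sub, div_le_div_iff₀ (by positivity)
        (by positivity)] at h1
      calc Real.exp (r * t) ≤ Real.exp (r * y) / y ^ p * t ^ p := by
            rw [div_mul_eq_mul_div, le_div_iff₀ (by positivity)]; linarith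
        _ ≤ _ := by
            gcongr
            exact htw.trans (le_abs_self w)
    have h3 : 0 ≤ Real.exp p * r ^ 2 * w ^ 2 := by positivity
    have h4 : 0 < r * w := mul_pos hr (by linarith)
    linarith

section FukNagaev

variable {Ω : Type*} {mΩ : MeasurableSpace Ω} {P : Measure Ω} [IsProbabilityMeasure P]

lemma integral_sq_le_of_integral_abs_rpow_le {p : ℝ} (hp : 2 ≤ p) {X : Ω → ℝ} {v : ℝ}
    (hv : 0 ≤ v) (hX : MemLp X (ENNReal.ofReal p) P)
    (h : ∫ ω, |X ω| ^ p ∂P ≤ v ^ (p / 2)) : ∫ ω, X ω ^ 2 ∂P ≤ v := by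
  have := integral_abs_rpow_mul_sq_le (a := fun _ => (1 : ℝ)) (V := 1) hp zero_le_one hv
    (memLp_const 1) hX (by simp) h
  simpa using this

lemma measureReal_le_abs_le_of_integral_abs_rpow_le {p : ℝ} (hp : 0 < p) {X : Ω → ℝ} {M : ℝ}
    (hX : MemLp X (ENNReal.ofReal p) P) (h : ∫ ω, |X ω| ^ p ∂P ≤ M) {y : ℝ} (hy : 0 < y) :
    P.real {ω | y ≤ |X ω|} ≤ M / y ^ p := by
  have h1 := mul_meas_ge_le_integral_of_nonneg (μ := P) (f := fun ω => |X ω| ^ p)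
    (.of_forall fun ω => by positivity) (hX.integrable_abs_rpow hp) (y ^ p)
  rw [le_div_iff₀ (by positivity), mul_comm]
  refine le_trans ?_ (h1.trans h)
  exact mul_le_mul_of_nonneg_left (measureReal_mono
    (fun ω hω => Real.rpow_le_rpow hy.le hω hp.le) (measure_ne_top _ _)) (by positivity)

lemma mgf_min_le {p : ℝ} (hp : 2 ≤ p) {X : Ω → ℝ} {v : ℝ} (hv : 0 ≤ v)
    (hX : MemLp X (ENNReal.ofReal p) P) (hmean : ∫ ω, X ω ∂P = 0)
    (h : ∫ ω, |X ω| ^ p ∂P ≤ v ^ (p / 2)) {r y : ℝ} (hr : 0 < r) (hy : 0 < y) :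
    mgf (fun ω => min (X ω) y) P r ≤
      Real.exp (Real.exp p * r ^ 2 * v + Real.exp (r * y) * (v ^ (p / 2) / y ^ p)) := by
  have hp1 : 1 ≤ ENNReal.ofReal p := by rw [ENNReal.one_le_ofReal]; linarith
  have hp2 : 2 ≤ ENNReal.ofReal p := by
    rw [← ENNReal.ofReal_ofNat]; exact ENNReal.ofReal_le_ofReal hp
  have i1 : Integrable (fun ω => 1 + r * X ω) P :=
    (integrable_const 1).add ((hX.integrable hp1).const_mul r)
  have i2 : Integrable (fun ω => Real.exp p * r ^ 2 * X ω ^ 2) P :=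
    (hX.mono_exponent hp2).integrable_sq.const_mul _
  have i3 : Integrable (fun ω => Real.exp (r * y) / y ^ p * |X ω| ^ p) P :=
    (hX.integrable_abs_rpow (by linarith)).const_mul _
  have i12 : Integrable (fun ω => 1 + r * X ω + Real.exp p * r ^ 2 * X ω ^ 2) P := i1.add i2
  have key : mgf (fun ω => min (X ω) y) P r ≤ ∫ ω, (1 + r * X ω + Real.exp p * r ^ 2 * X ω ^ 2
      + Real.exp (r * y) / y ^ p * |X ω| ^ p) ∂P :=
    integral_mono_of_nonneg (.of_forall fun ω => (Real.exp_pos _).le) (i12.add i3)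
      (.of_forall fun ω => exp_mul_min_le hp hr hy (X ω))
  rw [integral_add i12 i3, integral_add i1 i2, integral_add (integrable_const 1)
    ((hX.integrable hp1).const_mul r), integral_const_mul, integral_const_mul, integral_const_mul,
    hmean] at key
  simp only [integral_const, probReal_univ, smul_eq_mul, mul_one, mul_zero, add_zero] at key
  refine key.trans (le_trans ?_ (Real.add_one_le_exp _))
  have h2 := integral_sq_le_of_integral_abs_rpow_le hp hv hX h
  have h3 : Real.exp p * r ^ 2 * (∫ ω, X ω ^ 2 ∂P) ≤ Real.exp p * r ^ 2 * v := by gcongr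
  have h4 : Real.exp (r * y) / y ^ p * (∫ ω, |X ω| ^ p ∂P)
      ≤ Real.exp (r * y) / y ^ p * v ^ (p / 2) := by gcongr
  have h5 : Real.exp (r * y) / y ^ p * v ^ (p / 2)
      = Real.exp (r * y) * (v ^ (p / 2) / y ^ p) := by ring
  linarith

/-- The one-sided Fuk–Nagaev inequality for independent centred variables whose squared `L^p` norms
are at most `v`. -/
lemma measureReal_le_sum_le_of_iIndepFun {p : ℝ} (hp : 2 ≤ p) {W : ℕ → Ω → ℝ} {v : ℝ} (hv : 0 < v)
    (hW : ∀ b, Measurable (W b)) (hind : iIndepFun W P) (hmean : ∀ b, ∫ ω, W b ω ∂P = 0)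
    (hLp : ∀ b, MemLp (W b) (ENNReal.ofReal p) P)
    (hmom : ∀ b, ∫ ω, |W b ω| ^ p ∂P ≤ v ^ (p / 2)) (n : ℕ) {x : ℝ} (hx : 0 < x) :
    P.real {ω | x ≤ ∑ b ∈ Finset.range n, W b ω} ≤
      4 * (2 ^ p * n * v ^ (p / 2) / x ^ p + Real.exp (-(x ^ 2 / (6 * Real.exp p * (n * v))))) := by
  rcases Nat.eq_zero_or_pos n with rfl | hn
  · have : {ω : Ω | x ≤ ∑ b ∈ Finset.range 0, W b ω} = ∅ := by
      ext ω; simp [hx]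
    rw [this]; simp
  have hn' : (0 : ℝ) < n := by exact_mod_cast hn
  set y := x / 2 with hy
  have hy0 : 0 < y := by positivity
  set Q := n * (v ^ (p / 2) / y ^ p) with hQ
  have hQ0 : 0 < Q := by positivity
  have hQe : 2 ^ p * n * v ^ (p / 2) / x ^ p = Q := by
    rw [hQ, hy, Real.div_rpow hx.le (by norm_num)]; field_simp
  rw [hQe]
  set A := Real.exp p with hA
  have hA0 : 0 < A := Real.exp_pos p
  set E := Real.exp (-(x ^ 2 / (6 * A * (n * v)))) with hE
  have hE0 : 0 < E := Real.exp_pos _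
  rcases le_or_gt 1 Q with hQ1 | hQ1
  · have : P.real {ω | x ≤ ∑ b ∈ Finset.range n, W b ω} ≤ 1 := measureReal_le_one
    linarith
  -- the event splits into a large summand and a large sum of the variables truncated at `x / 2`
  have hsplit : {ω | x ≤ ∑ b ∈ Finset.range n, W b ω} ⊆
      (⋃ b ∈ Finset.range n, {ω | y ≤ |W b ω|}) ∪
        {ω | x ≤ (∑ b ∈ Finset.range n, fun ω => min (W b ω) y) ω} := by
    intro ω hω
    by_cases h : ∃ b ∈ Finset.range n, y ≤ |W b ω|
    · left; simpa using h
    · right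
      push Not at h
      have : ∑ b ∈ Finset.range n, min (W b ω) y = ∑ b ∈ Finset.range n, W b ω :=
        Finset.sum_congr rfl fun b hb => min_eq_left ((le_abs_self _).trans (h b hb).le)
      simpa [this] using hω
  have h1 : P.real (⋃ b ∈ Finset.range n, {ω | y ≤ |W b ω|}) ≤ Q := by
    refine (measureReal_biUnion_finset_le _ _).trans ?_
    refine (Finset.sum_le_sum fun b _ => measureReal_le_abs_le_of_integral_abs_rpow_le
      (by linarith) (hLp b) (hmom b) hy0).trans_eq ?_
    simp [hQ]
  have hmeas : ∀ b, Measurable (fun ω => min (W b ω) y) := fun b => (hW b).min measurable_const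
  have hindX : iIndepFun (fun b ω => min (W b ω) y) P :=
    hind.comp (fun _ z => min z y) fun _ => measurable_id.min measurable_const
  have h2 : ∀ r : ℝ, 0 < r →
      P.real {ω | x ≤ (∑ b ∈ Finset.range n, fun ω => min (W b ω) y) ω} ≤
        Real.exp (-(r * x) + A * r ^ 2 * (n * v) + Real.exp (r * y) * Q) := by
    intro r hr
    have hint : ∀ b ∈ Finset.range n, Integrable (fun ω => Real.exp (r * min (W b ω) y)) P := by
      intro b _
      refine Integrable.of_bound (C := Real.exp (r * y)) (by
        have := hmeas b
        exact Measurable.aestronglyMeasurable (by fun_prop)) (.of_forall fun ω => ?_)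
      rw [Real.norm_of_nonneg (Real.exp_pos _).le]
      gcongr
      exact min_le_right _ _
    refine (measure_ge_le_exp_mul_mgf x hr.le
      (hindX.integrable_exp_mul_sum hmeas hint)).trans ?_
    rw [hindX.mgf_sum hmeas]
    have h3 : ∏ b ∈ Finset.range n, mgf (fun ω => min (W b ω) y) P r ≤
        ∏ b ∈ Finset.range n,
          Real.exp (A * r ^ 2 * v + Real.exp (r * y) * (v ^ (p / 2) / y ^ p)) :=
      Finset.prod_le_prod (fun b _ => mgf_nonneg) fun b _ =>
        mgf_min_le hp hv.le (hLp b) (hmean b) (hmom b) hr hy0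
    rw [← Real.exp_sum, Finset.sum_const, Finset.card_range, nsmul_eq_mul] at h3
    refine (mul_le_mul_of_nonneg_left h3 (Real.exp_pos _).le).trans_eq ?_
    rw [← Real.exp_add, hQ]
    congr 1; ring
  -- the first candidate optimizes the quadratic part, the second keeps `exp (r * y) * Q ≤ 1`
  set r₁ := x / (4 * A * (n * v)) with hr₁
  set r₂ := Real.log (1 / Q) / y with hr₂
  have hr₁0 : 0 < r₁ := by positivity
  have hL : 0 < Real.log (1 / Q) := Real.log_pos (by rw [lt_div_iff₀ hQ0]; linarith)
  have hr₂0 : 0 < r₂ := by positivity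
  have hexpL : Real.exp (-Real.log (1 / Q)) = Q := by
    rw [one_div, Real.log_inv, neg_neg, Real.exp_log hQ0]
  have h4 : P.real {ω | x ≤ (∑ b ∈ Finset.range n, fun ω => min (W b ω) y) ω} ≤
      Real.exp 1 * (Q + E) := by
    have hr : 0 < min r₁ r₂ := lt_min hr₁0 hr₂0
    refine (h2 _ hr).trans ?_
    set r := min r₁ r₂ with hrdef
    have hq : A * r ^ 2 * (n * v) ≤ r * x / 4 := by
      have : r * (4 * A * (n * v)) ≤ x := by
        have := min_le_left r₁ r₂
        rwa [← hrdef, hr₁, le_div_iff₀ (by positivity)] at this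
      nlinarith
    have he : Real.exp (r * y) * Q ≤ 1 := by
      have : r * y ≤ Real.log (1 / Q) := by
        have := min_le_right r₁ r₂
        rwa [← hrdef, hr₂, le_div_iff₀ hy0] at this
      calc Real.exp (r * y) * Q ≤ Real.exp (Real.log (1 / Q)) * Q := by gcongr
        _ = 1 := by rw [Real.exp_log (by positivity)]; field_simp
    have hbound : Real.exp (-(3 / 4 * (r * x))) ≤ Q + E := by
      rcases min_choice r₁ r₂ with h | h
      · have : Real.exp (-(3 / 4 * (r * x))) ≤ E := by
          rw [hE, hrdef, h, Real.exp_le_exp, neg_le_neg_iff, hr₁]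
          rw [div_le_iff₀ (by positivity)]
          field_simp
          norm_num
        linarith
      · have : Real.exp (-(3 / 4 * (r * x))) ≤ Q := by
          conv_rhs => rw [← hexpL]
          rw [Real.exp_le_exp, neg_le_neg_iff, hrdef, h, hr₂]
          have : x = 2 * y := by rw [hy]; ring
          rw [this]
          field_simp
          norm_num
        linarith
    calc Real.exp (-(r * x) + A * r ^ 2 * (n * v) + Real.exp (r * y) * Q)
        ≤ Real.exp (1 + -(3 / 4 * (r * x))) := by
          rw [Real.exp_le_exp]; linarith
      _ = Real.exp 1 * Real.exp (-(3 / 4 * (r * x))) := Real.exp_add _ _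
      _ ≤ _ := by gcongr
  have h5 : P.real {ω | x ≤ ∑ b ∈ Finset.range n, W b ω} ≤ Q + Real.exp 1 * (Q + E) :=
    (measureReal_mono hsplit (measure_ne_top _ _)).trans
      ((measureReal_union_le _ _).trans (add_le_add h1 h4))
  have h6 : Real.exp 1 ≤ 3 := by linarith [Real.exp_one_lt_d9]
  nlinarith

lemma measureReal_le_abs_sum_le_of_iIndepFun {p : ℝ} (hp : 2 ≤ p) {W : ℕ → Ω → ℝ} {v : ℝ}
    (hv : 0 < v) (hW : ∀ b, Measurable (W b)) (hind : iIndepFun W P)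
    (hmean : ∀ b, ∫ ω, W b ω ∂P = 0) (hLp : ∀ b, MemLp (W b) (ENNReal.ofReal p) P)
    (hmom : ∀ b, ∫ ω, |W b ω| ^ p ∂P ≤ v ^ (p / 2)) (n : ℕ) {x : ℝ} (hx : 0 < x) :
    P.real {ω | x ≤ |∑ b ∈ Finset.range n, W b ω|} ≤
      8 * (2 ^ p * n * v ^ (p / 2) / x ^ p + Real.exp (-(x ^ 2 / (6 * Real.exp p * (n * v))))) := by
  have h1 := measureReal_le_sum_le_of_iIndepFun hp hv hW hind hmean hLp hmom n hx
  have h2 := measureReal_le_sum_le_of_iIndepFun (W := fun b ω => -W b ω) hp hv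
    (fun b => (hW b).neg) (hind.comp (fun _ z => -z) fun _ => measurable_neg)
    (fun b => by rw [integral_neg, hmean b, neg_zero]) (fun b => (hLp b).neg)
    (fun b => by simpa using hmom b) n hx
  have h3 : {ω | x ≤ |∑ b ∈ Finset.range n, W b ω|} ⊆
      {ω | x ≤ ∑ b ∈ Finset.range n, W b ω} ∪ {ω | x ≤ ∑ b ∈ Finset.range n, -W b ω} := by
    intro ω hω
    rcases le_abs.1 (show x ≤ |∑ b ∈ Finset.range n, W b ω| from hω) with h | h
    · exact Or.inl h
    · right; simpa using h
  have h4 := (measureReal_mono h3 (measure_ne_top P _)).trans (measureReal_union_le _ _)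
  linarith

/-- The σ-algebras generated by the initial segments of a sequence of random variables, the one
with index `k` excluding the `k`-th variable. -/
def initialFiltration (W : ℕ → Ω → ℝ) (hW : ∀ b, Measurable (W b)) : Filtration ℕ mΩ where
  seq k := ⨆ b ∈ Set.Iio k, MeasurableSpace.comap (W b) inferInstance
  mono' _ _ hij := biSup_mono fun _ hb => lt_of_lt_of_le hb hij
  le' _ := iSup₂_le fun b _ => (hW b).comap_le

/-- The Fuk–Nagaev inequality for the maximal partial sum, from the inequality for one sum and
Ottaviani's argument. -/
lemma measureReal_exists_le_abs_sum_le_of_iIndepFun {p : ℝ} (hp : 2 ≤ p) {W : ℕ → Ω → ℝ} {v : ℝ}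
    (hv : 0 < v) (hW : ∀ b, Measurable (W b)) (hind : iIndepFun W P)
    (hmean : ∀ b, ∫ ω, W b ω ∂P = 0) (hLp : ∀ b, MemLp (W b) (ENNReal.ofReal p) P)
    (hmom : ∀ b, ∫ ω, |W b ω| ^ p ∂P ≤ v ^ (p / 2)) (n : ℕ) {x : ℝ} (hx : 0 < x) :
    P.real {ω | ∃ k ≤ n, x ≤ |∑ b ∈ Finset.range k, W b ω|} ≤
      16 * (4 ^ p * n * v ^ (p / 2) / x ^ p
        + Real.exp (-(x ^ 2 / (24 * Real.exp p * (n * v))))) := by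
  have hp2 : 2 ≤ ENNReal.ofReal p := by
    rw [← ENNReal.ofReal_ofNat]; exact ENNReal.ofReal_le_ofReal hp
  have hLp2 : ∀ b, MemLp (W b) 2 P := fun b => (hLp b).mono_exponent hp2
  have hpos : 0 ≤ 4 ^ p * n * v ^ (p / 2) / x ^ p := by positivity
  rcases lt_or_ge (x ^ 2) (8 * (n * v)) with hsmall | hlarge
  · -- here the right-hand side exceeds one
    have hnv : 0 < (n : ℝ) * v := by nlinarith [sq_nonneg x]
    have h1 : x ^ 2 / (24 * Real.exp p * (n * v)) ≤ 1 / 3 := by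
      rw [div_le_iff₀ (by positivity)]
      have := Real.one_le_exp (show 0 ≤ p by linarith)
      nlinarith
    have h2 := Real.add_one_le_exp (-(x ^ 2 / (24 * Real.exp p * (n * v))))
    have h3 : P.real {ω | ∃ k ≤ n, x ≤ |∑ b ∈ Finset.range k, W b ω|} ≤ 1 := measureReal_le_one
    linarith
  set S : ℕ → Ω → ℝ := fun k ω => ∑ b ∈ Finset.range k, W b ω with hS
  have hSm : ∀ k, Measurable (S k) := fun k => by fun_prop
  set F : Set Ω := {ω | x / 2 ≤ |S n ω|} with hF
  have hFm : MeasurableSet F := measurableSet_le measurable_const (hSm n).abs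
  -- the increments after time `k` are small with probability at least one half
  have hinc : ∀ k ≤ n, P.real {ω | x / 2 ≤ |∑ b ∈ Finset.Ico k n, W b ω|} ≤ 1 / 2 := by
    intro k hk
    have hmemLp : MemLp (∑ b ∈ Finset.Ico k n, W b) 2 P := memLp_finsetSum' _ fun b _ => hLp2 b
    have hvar : Var[∑ b ∈ Finset.Ico k n, W b; P] ≤ n * v := by
      rw [IndepFun.variance_sum (fun b _ => hLp2 b) fun i _ j _ hij => hind.indepFun hij]
      calc ∑ b ∈ Finset.Ico k n, Var[W b; P] ≤ ∑ b ∈ Finset.Ico k n, v :=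
            Finset.sum_le_sum fun b _ =>
              (variance_le_expectation_sq (hLp2 b).1).trans
                (integral_sq_le_of_integral_abs_rpow_le hp hv.le (hLp b) (hmom b))
        _ ≤ n * v := by
            rw [Finset.sum_const, Nat.card_Ico, nsmul_eq_mul]
            gcongr
            exact Nat.sub_le _ _
    have hexp : ∫ ω, (∑ b ∈ Finset.Ico k n, W b) ω ∂P = 0 := by
      simp_rw [Finset.sum_apply]
      rw [integral_finsetSum _ fun b _ => (hLp2 b).integrable (by norm_num)]
      simp [hmean]
    have h1 := meas_ge_le_variance_div_sq hmemLp (half_pos hx)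
    rw [hexp] at h1
    have h2 := ENNReal.toReal_mono ENNReal.ofReal_ne_top h1
    rw [ENNReal.toReal_ofReal (div_nonneg (variance_nonneg _ _) (by positivity))] at h2
    have h3 : Var[∑ b ∈ Finset.Ico k n, W b; P] / (x / 2) ^ 2 ≤ 1 / 2 := by
      rw [div_le_iff₀ (by positivity)]; nlinarith
    refine le_trans (le_of_eq ?_) (h2.trans h3)
    simp [Measure.real]
  have hott : P.real {ω | ∃ k ≤ n, x ≤ |S k ω|} ≤ 2 * P.real F := by
    have h := measureReal_exists_le_of_forall_subset (P := P) (𝓖 := initialFiltration W hW)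
      (A := fun k => {ω | x ≤ |S k ω|}) (f := F.indicator fun _ => (2 : ℝ)) (n := n) ?_
      ((integrable_const _).indicator hFm)
      (fun ω => Set.indicator_nonneg (fun _ _ => by norm_num) ω) ?_
    · rw [integral_indicator hFm, setIntegral_const, smul_eq_mul] at h
      linarith [show P.real {ω | ∃ k ≤ n, x ≤ |S k ω|} ≤ P.real F * 2 from h]
    · intro k
      have : Measurable[initialFiltration W hW k] (S k) :=
        Finset.measurable_fun_sum _ fun b hb =>
          (comap_measurable (W b)).mono (le_biSup (fun b => MeasurableSpace.comap (W b) inferInstance)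
            (show b ∈ Set.Iio k from Finset.mem_range.1 hb)) le_rfl
      exact this (t := {z : ℝ | x ≤ |z|})
        (measurableSet_le measurable_const continuous_abs.measurable)
    · intro k hk B hB hBA
      rw [setIntegral_indicator hFm, setIntegral_const, smul_eq_mul]
      set G : Set Ω := {ω | x / 2 ≤ |∑ b ∈ Finset.Ico k n, W b ω|} with hG
      have hGm : MeasurableSet[⨆ b ∈ Set.Ici k, MeasurableSpace.comap (W b) inferInstance] G := by
        have : Measurable[⨆ b ∈ Set.Ici k, MeasurableSpace.comap (W b) inferInstance]
            (fun ω => ∑ b ∈ Finset.Ico k n, W b ω) :=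
          Finset.measurable_fun_sum _ fun b hb =>
            (comap_measurable (W b)).mono (le_biSup
              (fun b => MeasurableSpace.comap (W b) inferInstance)
              (show b ∈ Set.Ici k from (Finset.mem_Ico.1 hb).1)) le_rfl
        exact this (t := {z : ℝ | x / 2 ≤ |z|})
          (measurableSet_le measurable_const continuous_abs.measurable)
      have hindep := indep_iSup_of_disjoint (fun b => (hW b).comap_le) hind.iIndep
        (S := Set.Iio k) (T := Set.Ici k) (by
          rw [Set.disjoint_left]; exact fun b h1 h2 => absurd (Set.mem_Iio.1 h1) (not_lt.2 h2))
      have hBG : P.real (B ∩ G) = P.real B * P.real G := by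
        rw [Measure.real, (Indep_iff _ _ _).1 hindep B G hB hGm, ENNReal.toReal_mul]; rfl
      have hsub : B ⊆ (B ∩ F) ∪ (B ∩ G) := by
        intro ω hω
        by_cases hg : ω ∈ G
        · exact Or.inr ⟨hω, hg⟩
        · left
          refine ⟨hω, ?_⟩
          have h1 : x ≤ |S k ω| := hBA hω
          have h2 : |∑ b ∈ Finset.Ico k n, W b ω| < x / 2 := not_le.1 hg
          have h3 : S n ω = S k ω + ∑ b ∈ Finset.Ico k n, W b ω :=
            (Finset.sum_range_add_sum_Ico _ hk).symm
          have h4 : |S k ω| ≤ |S n ω| + |∑ b ∈ Finset.Ico k n, W b ω| := by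
            have := abs_sub (S n ω) (∑ b ∈ Finset.Ico k n, W b ω)
            rwa [h3, add_sub_cancel_right, ← h3] at this
          change x / 2 ≤ |S n ω|
          linarith
      have h5 := (measureReal_mono hsub (measure_ne_top P _)).trans (measureReal_union_le _ _)
      have h6 := hinc k hk
      have h7 : 0 ≤ P.real B := measureReal_nonneg
      rw [hBG] at h5
      nlinarith
  have h8 := measureReal_le_abs_sum_le_of_iIndepFun hp hv hW hind hmean hLp hmom n (half_pos hx)
  have e1 : 2 ^ p * n * v ^ (p / 2) / (x / 2) ^ p = 4 ^ p * n * v ^ (p / 2) / x ^ p := by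
    rw [Real.div_rpow hx.le (by norm_num), show (4 : ℝ) = 2 * 2 by norm_num,
      Real.mul_rpow (by norm_num) (by norm_num)]
    field_simp
  have e2 : (x / 2) ^ 2 / (6 * Real.exp p * (n * v)) = x ^ 2 / (24 * Real.exp p * (n * v)) := by
    rw [div_pow, div_div]; congr 1; ring
  rw [e1, e2] at h8
  linarith

end FukNagaev

/-! ### Blocking of `m`-dependent reverse martingale differences -/

section Blocks

variable {Ω : Type*} {mΩ : MeasurableSpace Ω} {P : Measure Ω}

/-- A two-sided sequence of reverse martingale differences: `y s` is known from the `σ`-algebra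
`𝓗 s` of the present and the future, and has conditional mean zero given the strict future. -/
structure IsReverseMartingaleDiff (y : ℤ → Ω → ℝ) (𝓗 : ℤ → MeasurableSpace Ω) (P : Measure Ω) :
    Prop where
  antitone : Antitone 𝓗
  le : ∀ s, 𝓗 s ≤ mΩ
  adapted : ∀ s, StronglyMeasurable[𝓗 s] (y s)
  condExp : ∀ s, P[y s | 𝓗 (s + 1)] =ᵐ[P] 0

/-- A sequence is `m`-dependent if its terms before any time `s` are independent of those from time
`s + m` on. -/
def IsMDependent (y : ℤ → Ω → ℝ) (m : ℕ) (P : Measure Ω) : Prop :=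
  ∀ s : ℤ, Indep (⨆ i ∈ Set.Iio s, MeasurableSpace.comap (y i) inferInstance)
    (⨆ i ∈ Set.Ici (s + m), MeasurableSpace.comap (y i) inferInstance) P

lemma iIndepFun_of_forall_indep_initial [IsProbabilityMeasure P] {W : ℕ → Ω → ℝ}
    (h : ∀ n, Indep (⨆ k ∈ Set.Iio n, MeasurableSpace.comap (W k) inferInstance)
      (MeasurableSpace.comap (W n) inferInstance) P) : iIndepFun W P := by
  rw [iIndepFun_iff]
  intro s
  induction s using Finset.induction_on_max with
  | empty => simp
  | insert n s hs ih =>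
    intro f' hf'
    have hn : n ∉ s := fun hn => lt_irrefl _ (hs n hn)
    rw [Finset.prod_insert hn, Finset.set_biInter_insert, Set.inter_comm,
      ← ih fun i hi => hf' i (Finset.mem_insert_of_mem hi), mul_comm]
    refine (Indep_iff _ _ _).1 (h n) _ _ ?_ (hf' n (Finset.mem_insert_self _ _))
    exact Finset.measurableSet_biInter _ fun i hi =>
      le_biSup (fun k => MeasurableSpace.comap (W k) inferInstance)
        (show i ∈ Set.Iio n from hs i hi) _ (hf' i (Finset.mem_insert_of_mem hi))

lemma sum_range_reverse_add_sum_range {m : ℕ} (f : ℤ → ℝ) (a : ℤ) {j : ℕ} (hj : j ≤ m) :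
    ∑ q ∈ Finset.range j, f (a + m - 1 - q) + ∑ r ∈ Finset.range (m - j), f (a + r)
      = ∑ r ∈ Finset.range m, f (a + r) := by
  induction j with
  | zero => simp
  | succ j ih =>
    rw [← ih (by omega), Finset.sum_range_succ, show m - j = (m - (j + 1)) + 1 by omega,
      Finset.sum_range_succ _ (m - (j + 1)), show a + ((m - (j + 1) : ℕ) : ℤ) = a + m - 1 - j by
        rw [Nat.cast_sub hj]; push_cast; ring]
    ring

namespace IsReverseMartingaleDiff

variable {y : ℤ → Ω → ℝ} {𝓗 : ℤ → MeasurableSpace Ω}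

/-- The filtration of a sequence of reverse martingale differences read backwards from time `t`. -/
def reverseFiltration (hy : IsReverseMartingaleDiff y 𝓗 P) (t : ℤ) : Filtration ℕ mΩ where
  seq q := 𝓗 (t - q + 1)
  mono' i j hij := hy.antitone (by have : (i : ℤ) ≤ j := by exact_mod_cast hij
                                   linarith)
  le' _ := hy.le _

lemma isMartingaleDiff (hy : IsReverseMartingaleDiff y 𝓗 P) (t : ℤ) :
    IsMartingaleDiff (fun q : ℕ => y (t - q)) (hy.reverseFiltration t) P where
  adapted q := by
    have h := hy.adapted (t - q)
    have e : t - ((q + 1 : ℕ) : ℤ) + 1 = t - q := by push_cast; ring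
    change StronglyMeasurable[𝓗 (t - ((q + 1 : ℕ) : ℤ) + 1)] _
    rwa [e]
  condExp q := hy.condExp (t - q)

lemma measurable (hy : IsReverseMartingaleDiff y 𝓗 P) (s : ℤ) : Measurable (y s) :=
  ((hy.adapted s).mono (hy.le s)).measurable

variable [IsProbabilityMeasure P] {p v : ℝ}

lemma integral_abs_sum_rpow_le (hy : IsReverseMartingaleDiff y 𝓗 P) (hp : 2 ≤ p) (hv : 0 ≤ v)
    (hLp : ∀ s, MemLp (y s) (ENNReal.ofReal p) P)
    (hmom : ∀ s, ∫ ω, |y s ω| ^ p ∂P ≤ v ^ (p / 2)) (a : ℤ) (m : ℕ) :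
    ∫ ω, |∑ r ∈ Finset.range m, y (a + r) ω| ^ p ∂P ≤ (momentConst p * (m * v)) ^ (p / 2) := by
  have h := (hy.isMartingaleDiff (a + m - 1)).integral_abs_sum_rpow_le hp hv (fun q => hLp _)
    (fun q => hmom _) m
  refine le_of_eq_of_le ?_ h
  congr 1 with ω
  have e := sum_range_reverse_add_sum_range (fun s => y s ω) a (le_refl m)
  simp only [tsub_self, Finset.range_zero, Finset.sum_empty, add_zero] at e
  rw [e]

/-- The maximal inequality over a block of length `m`. A partial sum from the left end of the block
is the difference of two partial sums of the time-reversed martingale. -/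
lemma measureReal_exists_le_abs_sum (hy : IsReverseMartingaleDiff y 𝓗 P) (hp : 2 ≤ p) (hv : 0 ≤ v)
    (hLp : ∀ s, MemLp (y s) (ENNReal.ofReal p) P)
    (hmom : ∀ s, ∫ ω, |y s ω| ^ p ∂P ≤ v ^ (p / 2)) (a : ℤ) (m : ℕ) {x : ℝ} (hx : 0 < x) :
    P.real {ω | ∃ k ≤ m, x ≤ |∑ r ∈ Finset.range k, y (a + r) ω|} ≤
      2 ^ p * (momentConst p * (m * v)) ^ (p / 2) / x ^ p := by
  have hmd := hy.isMartingaleDiff (a + m - 1)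
  have h := hmd.measureReal_exists_le_abs_sum hp (fun q => hLp _) (half_pos hx) m
  have h2 := hmd.integral_abs_sum_rpow_le hp hv (fun q => hLp _) (fun q => hmom _) m
  have hsub : {ω | ∃ k ≤ m, x ≤ |∑ r ∈ Finset.range k, y (a + r) ω|} ⊆
      {ω | ∃ k ≤ m, x / 2 ≤ |∑ q ∈ Finset.range k, y (a + m - 1 - q) ω|} := by
    rintro ω ⟨k, hk, hω⟩
    have e1 := sum_range_reverse_add_sum_range (fun s => y s ω) a (le_refl m)
    have e2 := sum_range_reverse_add_sum_range (fun s => y s ω) a (Nat.sub_le m k)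
    simp only [tsub_self, Finset.range_zero, Finset.sum_empty, add_zero] at e1
    rw [Nat.sub_sub_self hk, ← e1] at e2
    by_contra hcon
    simp only [Set.mem_ofPred_eq, not_exists, not_and, not_le] at hcon
    have h3 := hcon m le_rfl
    have h4 := hcon (m - k) (Nat.sub_le m k)
    rw [← e2] at h3
    have h5 := abs_sub (∑ q ∈ Finset.range (m - k), y (a + m - 1 - q) ω
      + ∑ r ∈ Finset.range k, y (a + r) ω) (∑ q ∈ Finset.range (m - k), y (a + m - 1 - q) ω)
    rw [add_sub_cancel_left] at h5
    linarith
  refine (measureReal_mono hsub (measure_ne_top _ _)).trans (h.trans ?_)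
  rw [Real.div_rpow hx.le (by norm_num), div_div_eq_mul_div, mul_comm (2 ^ p)]
  gcongr

/-- Every second block of length `m` of an `m`-dependent sequence: the block sums are independent,
and the Fuk–Nagaev inequality applies to them. -/
lemma measureReal_exists_le_abs_sum_blocks (hy : IsReverseMartingaleDiff y 𝓗 P) {m : ℕ}
    (hm : 0 < m) (hdep : IsMDependent y m P) (hp : 2 ≤ p) (hv : 0 < v)
    (hLp : ∀ s, MemLp (y s) (ENNReal.ofReal p) P)
    (hmom : ∀ s, ∫ ω, |y s ω| ^ p ∂P ≤ v ^ (p / 2)) (a : ℤ) (n : ℕ) {x : ℝ} (hx : 0 < x) :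
    P.real {ω | ∃ k ≤ n,
        x ≤ |∑ b ∈ Finset.range k, ∑ r ∈ Finset.range m, y (a + (2 * b * m : ℕ) + r) ω|} ≤
      16 * (4 ^ p * n * (momentConst p * (m * v)) ^ (p / 2) / x ^ p
        + Real.exp (-(x ^ 2 / (24 * Real.exp p * (n * (momentConst p * (m * v))))))) := by
  have hC := momentConst_pos hp
  have hint : ∀ s, Integrable (y s) P := fun s =>
    (hLp s).integrable (by rw [ENNReal.one_le_ofReal]; linarith)
  have hmean : ∀ s, ∫ ω, y s ω ∂P = 0 := fun s => by
    rw [← integral_condExp (hy.le (s + 1)), integral_congr_ae (hy.condExp s)]; simp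
  have hblock : ∀ (S : Set ℤ) (b : ℕ), (∀ r < m, a + (2 * b * m : ℕ) + r ∈ S) →
      Measurable[⨆ i ∈ S, MeasurableSpace.comap (y i) inferInstance]
        (fun ω => ∑ r ∈ Finset.range m, y (a + (2 * b * m : ℕ) + r) ω) := by
    intro S b hS
    exact Finset.measurable_fun_sum _ fun r hr =>
      (comap_measurable _).mono (le_biSup (fun i => MeasurableSpace.comap (y i) inferInstance)
        (hS r (Finset.mem_range.1 hr))) le_rfl
  refine measureReal_exists_le_abs_sum_le_of_iIndepFun hp (by positivity)
    (fun b => ?_) (iIndepFun_of_forall_indep_initial fun n => ?_) (fun b => ?_)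
    (fun b => memLp_finsetSum _ fun r _ => hLp _)
    (fun b => hy.integral_abs_sum_rpow_le hp hv.le hLp hmom _ m) n hx
  · have := hy.measurable
    fun_prop
  · refine indep_of_indep_of_le (hdep (a + ((2 * n * m : ℕ) : ℤ) - m))
      (iSup₂_le fun b hb => (hblock _ b fun r hr => ?_).comap_le) (hblock _ n fun r hr => ?_).comap_le
    · have hb' : b + 1 ≤ n := hb
      have h1 : 2 * b * m + 2 * m ≤ 2 * n * m := by nlinarith
      rw [Set.mem_Iio]
      push_cast
      zify at h1
      have : (r : ℤ) < m := by exact_mod_cast hr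
      linarith
    · rw [Set.mem_Ici]; linarith
  · rw [integral_finsetSum _ fun r _ => hint _]
    simp [hmean]

end IsReverseMartingaleDiff

lemma sum_range_mul_eq_sum_sum (f : ℕ → ℝ) (m b : ℕ) :
    ∑ s ∈ Finset.range (b * m), f s = ∑ c ∈ Finset.range b, ∑ r ∈ Finset.range m, f (c * m + r) := by
  induction b with
  | zero => simp
  | succ b ih => rw [Nat.succ_mul, Finset.sum_range_add, ih, Finset.sum_range_succ]

lemma sum_range_eq_sum_even_add_sum_odd (g : ℕ → ℝ) (b : ℕ) :
    ∑ c ∈ Finset.range b, g c = ∑ c ∈ Finset.range ((b + 1) / 2), g (2 * c)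
      + ∑ c ∈ Finset.range (b / 2), g (2 * c + 1) := by
  induction b with
  | zero => simp
  | succ b ih =>
    rw [Finset.sum_range_succ, ih]
    obtain ⟨e, rfl | rfl⟩ := Nat.even_or_odd' b
    · rw [show (2 * e + 1 + 1) / 2 = e + 1 by omega, show (2 * e + 1) / 2 = e by omega,
        show 2 * e / 2 = e by omega, Finset.sum_range_succ]
      ring
    · rw [show (2 * e + 1 + 1 + 1) / 2 = e + 1 by omega, show (2 * e + 1 + 1) / 2 = e + 1 by omega,
        show (2 * e + 1) / 2 = e by omega, Finset.sum_range_succ (fun c => g (2 * c + 1))]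
      ring

/-- The factor of the polynomial term in the Fuk–Nagaev inequality for `m`-dependent reverse
martingale differences. -/
noncomputable def polyConst (p : ℝ) : ℝ := 34 * 12 ^ p * momentConst p ^ (p / 2)

/-- The variance inflation in the exponential term of the Fuk–Nagaev inequality for `m`-dependent
reverse martingale differences. -/
noncomputable def expConst (p : ℝ) : ℝ := 216 * Real.exp p * momentConst p

lemma polyConst_pos {p : ℝ} (hp : 2 ≤ p) : 0 < polyConst p := by
  have := momentConst_pos hp; unfold polyConst; positivity

lemma expConst_pos {p : ℝ} (hp : 2 ≤ p) : 0 < expConst p := by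
  have := momentConst_pos hp; unfold expConst; positivity

/-- The Fuk–Nagaev inequality for `m`-dependent reverse martingale differences. -/
lemma IsReverseMartingaleDiff.fukNagaev [IsProbabilityMeasure P] {y : ℤ → Ω → ℝ}
    {𝓗 : ℤ → MeasurableSpace Ω} (hy : IsReverseMartingaleDiff y 𝓗 P) {m : ℕ}
    (hm : 0 < m) (hdep : IsMDependent y m P) {p v : ℝ} (hp : 2 ≤ p) (hv : 0 < v)
    (hLp : ∀ s, MemLp (y s) (ENNReal.ofReal p) P)
    (hmom : ∀ s, ∫ ω, |y s ω| ^ p ∂P ≤ v ^ (p / 2)) (a : ℤ) {T : ℕ} (hT : 0 < T)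
    {x : ℝ} (hx : 0 < x) :
    P.real {ω | ∃ t ≤ T, x ≤ |∑ s ∈ Finset.range t, y (a + s) ω|} ≤
      polyConst p * (T * (m : ℝ) ^ (p / 2 - 1) * v ^ (p / 2) / x ^ p)
        + 32 * Real.exp (-(x ^ 2 / (expConst p * (T * v)))) := by
  have hC := momentConst_pos hp
  have hm' : (0 : ℝ) < m := by exact_mod_cast hm
  have hT' : (0 : ℝ) < T := by exact_mod_cast hT
  have hsplit : ∀ z : ℝ, 0 < z → z ^ (p / 2) = z * z ^ (p / 2 - 1) := by
    intro z hz
    rw [mul_comm, ← Real.rpow_add_one hz.ne']; norm_num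
  have h12 : (1 : ℝ) ≤ 12 ^ p := Real.one_le_rpow (by norm_num) (by linarith)
  have hexp := Real.exp_pos (-(x ^ 2 / (expConst p * (T * v))))
  rcases lt_or_ge T m with hTm | hmT
  · -- a single block, no independence is needed
    refine (hy.measureReal_exists_le_abs_sum hp hv.le hLp hmom a T hx).trans ?_
    have h1 : (T : ℝ) ^ (p / 2 - 1) ≤ (m : ℝ) ^ (p / 2 - 1) :=
      Real.rpow_le_rpow hT'.le (by exact_mod_cast hTm.le) (by linarith)
    have h2 : 2 ^ p * (momentConst p * (T * v)) ^ (p / 2) / x ^ p ≤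
        polyConst p * (T * (m : ℝ) ^ (p / 2 - 1) * v ^ (p / 2) / x ^ p) := by
      rw [← mul_div_assoc]
      gcongr ?_ / _
      rw [Real.mul_rpow hC.le (by positivity), Real.mul_rpow hT'.le hv.le, hsplit _ hT', polyConst]
      have h3 : (2 : ℝ) ^ p ≤ 34 * 12 ^ p := by
        have : (2 : ℝ) ^ p ≤ 12 ^ p := Real.rpow_le_rpow (by norm_num) (by norm_num) (by linarith)
        linarith
      calc (2 : ℝ) ^ p * (momentConst p ^ (p / 2) * (T * (T : ℝ) ^ (p / 2 - 1) * v ^ (p / 2)))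
          ≤ (34 * 12 ^ p) * (momentConst p ^ (p / 2) * (T * (m : ℝ) ^ (p / 2 - 1) * v ^ (p / 2))) := by
            gcongr
        _ = _ := by ring
    linarith
  · set n := T / m with hn
    have hn1 : 1 ≤ n := (Nat.one_le_div_iff hm).2 hmT
    have hnm : (n : ℝ) * m ≤ T := by exact_mod_cast Nat.div_mul_le_self T m
    have hn1' : (1 : ℝ) ≤ n := by exact_mod_cast hn1
    set τ := momentConst p * (m * v) with hτ
    have hτ0 : 0 < τ := by positivity
    have hx3 : 0 < x / 3 := by positivity
    -- even blocks, odd blocks, and the incomplete last block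
    have hsub : {ω | ∃ t ≤ T, x ≤ |∑ s ∈ Finset.range t, y (a + s) ω|} ⊆
        ({ω | ∃ k ≤ n, x / 3 ≤
            |∑ b ∈ Finset.range k, ∑ r ∈ Finset.range m, y (a + (2 * b * m : ℕ) + r) ω|} ∪
          {ω | ∃ k ≤ n, x / 3 ≤
            |∑ b ∈ Finset.range k, ∑ r ∈ Finset.range m, y (a + m + (2 * b * m : ℕ) + r) ω|}) ∪
        ⋃ b ∈ Finset.range (n + 1),
          {ω | ∃ k ≤ m, x / 3 ≤ |∑ r ∈ Finset.range k, y (a + (b * m : ℕ) + r) ω|} := by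
      rintro ω ⟨t, ht, hω⟩
      by_contra hcon
      simp only [Set.mem_union, Set.mem_ofPred_eq, Set.mem_iUnion, not_or, not_exists, not_and,
        not_le, Finset.mem_range, exists_prop] at hcon
      obtain ⟨⟨h1, h2⟩, h3⟩ := hcon
      set b := t / m with hb
      have hbn : b ≤ n := Nat.div_le_div_right ht
      have e1 : ∑ s ∈ Finset.range t, y (a + s) ω
          = ∑ c ∈ Finset.range ((b + 1) / 2), ∑ r ∈ Finset.range m, y (a + (2 * c * m : ℕ) + r) ω
          + ∑ c ∈ Finset.range (b / 2), ∑ r ∈ Finset.range m, y (a + m + (2 * c * m : ℕ) + r) ω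
          + ∑ r ∈ Finset.range (t % m), y (a + (b * m : ℕ) + r) ω := by
        conv_lhs => rw [← Nat.div_add_mod' t m, Finset.sum_range_add,
          sum_range_mul_eq_sum_sum (fun s => y (a + s) ω), sum_range_eq_sum_even_add_sum_odd]
        congr 1
        · congr 1
          · refine Finset.sum_congr rfl fun c _ => Finset.sum_congr rfl fun r _ => ?_
            rw [Nat.cast_add, add_assoc]
          · refine Finset.sum_congr rfl fun c _ => Finset.sum_congr rfl fun r _ => ?_
            exact congrArg (fun z => y z ω) (by push_cast; ring)
        · refine Finset.sum_congr rfl fun r _ => ?_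
          rw [Nat.cast_add, add_assoc]
      have g1 := h1 ((b + 1) / 2) (by omega)
      have g2 := h2 (b / 2) (by omega)
      have g3 := h3 b (by omega) (t % m) (Nat.mod_lt t hm).le
      rw [e1] at hω
      have g4 := abs_add_three (∑ c ∈ Finset.range ((b + 1) / 2), ∑ r ∈ Finset.range m,
        y (a + (2 * c * m : ℕ) + r) ω) (∑ c ∈ Finset.range (b / 2), ∑ r ∈ Finset.range m,
        y (a + m + (2 * c * m : ℕ) + r) ω) (∑ r ∈ Finset.range (t % m), y (a + (b * m : ℕ) + r) ω)
      linarith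
    have hE := hy.measureReal_exists_le_abs_sum_blocks hm hdep hp hv hLp hmom a n hx3
    have hO := hy.measureReal_exists_le_abs_sum_blocks hm hdep hp hv hLp hmom (a + m) n hx3
    have hI : P.real (⋃ b ∈ Finset.range (n + 1),
        {ω | ∃ k ≤ m, x / 3 ≤ |∑ r ∈ Finset.range k, y (a + (b * m : ℕ) + r) ω|}) ≤
        (n + 1) * (2 ^ p * τ ^ (p / 2) / (x / 3) ^ p) := by
      refine (measureReal_biUnion_finset_le _ _).trans ?_
      refine (Finset.sum_le_sum fun b _ =>
        hy.measureReal_exists_le_abs_sum hp hv.le hLp hmom _ m hx3).trans_eq ?_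
      simp [hτ]
    have htotal := (measureReal_mono hsub (measure_ne_top P _)).trans
      ((measureReal_union_le _ _).trans (add_le_add ((measureReal_union_le _ _).trans
        (add_le_add hE hO)) hI))
    refine htotal.trans ?_
    have hexp' : Real.exp (-((x / 3) ^ 2 / (24 * Real.exp p * (n * τ)))) ≤
        Real.exp (-(x ^ 2 / (expConst p * (T * v)))) := by
      rw [Real.exp_le_exp, neg_le_neg_iff, div_pow, div_div]
      refine div_le_div_of_nonneg_left (sq_nonneg x) (by positivity) ?_
      rw [expConst]
      calc 3 ^ 2 * (24 * Real.exp p * (n * τ))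
          = 216 * Real.exp p * momentConst p * (n * m * v) := by rw [hτ]; ring
        _ ≤ _ := by gcongr
    have hpoly : n * τ ^ (p / 2) ≤
        momentConst p ^ (p / 2) * (T * (m : ℝ) ^ (p / 2 - 1) * v ^ (p / 2)) := by
      rw [hτ, Real.mul_rpow hC.le (by positivity), Real.mul_rpow hm'.le hv.le, hsplit _ hm']
      calc n * (momentConst p ^ (p / 2) * (m * (m : ℝ) ^ (p / 2 - 1) * v ^ (p / 2)))
          = momentConst p ^ (p / 2) * (n * m * (m : ℝ) ^ (p / 2 - 1) * v ^ (p / 2)) := by ring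
        _ ≤ _ := by gcongr
    have h4 : (4 : ℝ) ^ p * n * τ ^ (p / 2) / (x / 3) ^ p = 12 ^ p * (n * τ ^ (p / 2)) / x ^ p := by
      have : (12 : ℝ) ^ p = 4 ^ p * 3 ^ p := by
        rw [← Real.mul_rpow (by norm_num) (by norm_num)]; norm_num
      rw [Real.div_rpow hx.le (by norm_num), this]
      field_simp
    have h5 : (2 : ℝ) ^ p * τ ^ (p / 2) / (x / 3) ^ p = 6 ^ p * τ ^ (p / 2) / x ^ p := by
      have : (6 : ℝ) ^ p = 2 ^ p * 3 ^ p := by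
        rw [← Real.mul_rpow (by norm_num) (by norm_num)]; norm_num
      rw [Real.div_rpow hx.le (by norm_num), this]
      field_simp
    rw [h4, h5]
    have h6 : (n + 1) * (6 ^ p * τ ^ (p / 2) / x ^ p) ≤ 2 * (12 ^ p * (n * τ ^ (p / 2)) / x ^ p) := by
      have : (6 : ℝ) ^ p ≤ 12 ^ p := Real.rpow_le_rpow (by norm_num) (by norm_num) (by linarith)
      calc (n + 1) * (6 ^ p * τ ^ (p / 2) / x ^ p) ≤ (2 * n) * (12 ^ p * τ ^ (p / 2) / x ^ p) := by
            gcongr; linarith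
        _ = _ := by ring
    have h7 : 34 * (12 ^ p * (n * τ ^ (p / 2)) / x ^ p) ≤
        polyConst p * (T * (m : ℝ) ^ (p / 2 - 1) * v ^ (p / 2) / x ^ p) := by
      calc 34 * (12 ^ p * (n * τ ^ (p / 2)) / x ^ p) ≤ 34 * (12 ^ p * (momentConst p ^ (p / 2)
            * (T * (m : ℝ) ^ (p / 2 - 1) * v ^ (p / 2))) / x ^ p) := by gcongr
        _ = _ := by rw [polyConst]; ring
    linarith

end Blocks

/-! ### One lag of the moving average -/

section Innovations

variable {Ω : Type*} {mΩ : MeasurableSpace Ω} {P : Measure Ω} {N : ℕ}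

/-- The `σ`-algebra generated by the innovations with time index in `A`. -/
abbrev timeAlgebra (ε : ℤ → Ω → Fin N → ℝ) (A : Set ℤ) : MeasurableSpace Ω :=
  ⨆ q ∈ {q : Fin N × ℤ | q.2 ∈ A}, MeasurableSpace.comap (fun ω => ε q.2 ω q.1) inferInstance

lemma timeAlgebra_mono (ε : ℤ → Ω → Fin N → ℝ) {A A' : Set ℤ} (h : A ⊆ A') :
    timeAlgebra ε A ≤ timeAlgebra ε A' :=
  biSup_mono fun _ hq => h hq

lemma measurable_timeAlgebra (ε : ℤ → Ω → Fin N → ℝ) {A : Set ℤ} {t : ℤ} (ht : t ∈ A) (i : Fin N) :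
    Measurable[timeAlgebra ε A] (fun ω => ε t ω i) :=
  (comap_measurable (fun ω => ε t ω i)).mono
    (le_biSup (fun q : Fin N × ℤ => MeasurableSpace.comap (fun ω => ε q.2 ω q.1) inferInstance)
      (show (i, t) ∈ {q : Fin N × ℤ | q.2 ∈ A} from ht)) le_rfl

lemma IsInnovation.timeAlgebra_le {J K : ℝ} {ε : ℤ → Ω → Fin N → ℝ} (hε : IsInnovation P J K ε)
    (A : Set ℤ) : timeAlgebra ε A ≤ mΩ :=
  iSup₂_le fun q _ => (hε.measurable q.1 q.2).comap_le

lemma IsInnovation.indep_timeAlgebra {J K : ℝ} {ε : ℤ → Ω → Fin N → ℝ} (hε : IsInnovation P J K ε)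
    {A A' : Set ℤ} (h : Disjoint A A') : Indep (timeAlgebra ε A) (timeAlgebra ε A') P :=
  indep_iSup_of_disjoint
    (m := fun q : Fin N × ℤ => MeasurableSpace.comap (fun ω => ε q.2 ω q.1) inferInstance)
    (S := {q | q.2 ∈ A}) (T := {q | q.2 ∈ A'})
    (fun q => (hε.measurable q.1 q.2).comap_le) hε.indep.iIndep
    (Set.disjoint_left.2 fun _ hq hq' => Set.disjoint_left.1 h hq hq')

lemma integral_abs_rpow_le_of_eLpNorm_le {p K : ℝ} (hp : 2 ≤ p) (hK : 0 ≤ K) {f : Ω → ℝ}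
    (hf : AEStronglyMeasurable f P) (h : eLpNorm f (ENNReal.ofReal p) P ≤ ENNReal.ofReal K) :
    MemLp f (ENNReal.ofReal p) P ∧ ∫ ω, |f ω| ^ p ∂P ≤ (K ^ 2) ^ (p / 2) := by
  have hp0 : 0 < p := by linarith
  have hmem : MemLp f (ENNReal.ofReal p) P := ⟨hf, h.trans_lt ENNReal.ofReal_lt_top⟩
  refine ⟨hmem, ?_⟩
  rw [hmem.eLpNorm_eq_integral_rpow_norm (by simpa using hp0) ENNReal.ofReal_ne_top,
    ENNReal.ofReal_le_ofReal_iff hK, ENNReal.toReal_ofReal hp0.le] at h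
  have h0 : 0 ≤ ∫ ω, |f ω| ^ p ∂P := integral_nonneg fun ω => by positivity
  have h1 := Real.rpow_le_rpow (by positivity) h hp0.le
  simp only [Real.norm_eq_abs] at h1
  rw [← Real.rpow_mul h0, inv_mul_cancel₀ hp0.ne', Real.rpow_one] at h1
  rw [← Real.rpow_natCast, ← Real.rpow_mul hK]
  convert h1 using 2
  push_cast; ring

lemma memLp_mul_and_integral_abs_mul_rpow_le_of_indepFun {p : ℝ} (hp : 2 ≤ p) {U w : Ω → ℝ}
    {a b : ℝ} (ha : 0 ≤ a) (hb : 0 ≤ b) (hind : IndepFun U w P)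
    (hU : MemLp U (ENNReal.ofReal p) P) (hw : MemLp w (ENNReal.ofReal p) P)
    (hUa : ∫ ω, |U ω| ^ p ∂P ≤ a ^ (p / 2)) (hwb : ∫ ω, |w ω| ^ p ∂P ≤ b ^ (p / 2)) :
    MemLp (fun ω => U ω * w ω) (ENNReal.ofReal p) P ∧
      ∫ ω, |U ω * w ω| ^ p ∂P ≤ (a * b) ^ (p / 2) := by
  have hp0 : 0 < p := by linarith
  have hi : IndepFun (fun ω => |U ω| ^ p) (fun ω => |w ω| ^ p) P :=
    hind.comp (φ := fun z : ℝ => |z| ^ p) (ψ := fun z : ℝ => |z| ^ p) (by fun_prop) (by fun_prop)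
  have e : ∀ ω, |U ω * w ω| ^ p = |U ω| ^ p * |w ω| ^ p := fun ω => by
    rw [abs_mul, Real.mul_rpow (abs_nonneg _) (abs_nonneg _)]
  have hUi := hU.integrable_abs_rpow hp0
  have hwi := hw.integrable_abs_rpow hp0
  constructor
  · rw [← integrable_norm_rpow_iff (f := fun ω => U ω * w ω) (hU.1.mul hw.1) (by simpa using hp0) ENNReal.ofReal_ne_top,
      ENNReal.toReal_ofReal hp0.le]
    have := hi.integrable_mul hUi hwi
    refine this.congr (.of_forall fun ω => ?_)
    simp only [Pi.mul_apply, Real.norm_eq_abs, e ω]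
  · simp_rw [e]
    rw [hi.integral_fun_mul_eq_mul_integral hUi.1 hwi.1, Real.mul_rpow ha hb]
    gcongr

variable [IsProbabilityMeasure P]

lemma IsInnovation.linearForm {J K : ℝ} (hJ : 2 ≤ J) (hK : 0 ≤ K) {ε : ℤ → Ω → Fin N → ℝ}
    (hε : IsInnovation P J K ε) (β : Fin N → ℝ) (t : ℤ) :
    MemLp (fun ω => ∑ c, β c * ε t ω c) (ENNReal.ofReal J) P ∧
      ∫ ω, |∑ c, β c * ε t ω c| ^ J ∂P ≤ (momentConst J * (K ^ 2 * ∑ c, β c ^ 2)) ^ (J / 2) ∧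
      ∫ ω, ∑ c, β c * ε t ω c ∂P = 0 := by
  have hmom := fun c => integral_abs_rpow_le_of_eLpNorm_le hJ hK
    (hε.measurable c t).aestronglyMeasurable (hε.moment c t)
  have hind : iIndepFun (fun c ω => β c * ε t ω c) P :=
    (hε.indep.precomp (g := fun c : Fin N => (c, t)) fun a b h => (Prod.ext_iff.1 h).1).comp
      (fun c z => β c * z) fun c => measurable_const_mul _
  have h := memLp_sum_and_integral_abs_sum_rpow_le_of_iIndepFun hJ
    (X := fun c ω => β c * ε t ω c) (v := fun c => K ^ 2 * β c ^ 2)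
    (fun c => (hε.measurable c t).const_mul _) hind
    (fun c => by rw [integral_const_mul, hε.mean, mul_zero]) (fun c => by positivity)
    (fun c => (hmom c).1.const_mul _) (fun c => ?_) Finset.univ
  · rw [← Finset.mul_sum] at h
    refine ⟨h.1, h.2, ?_⟩
    rw [integral_finsetSum _ fun c _ => ((hmom c).1.integrable
      (by rw [ENNReal.one_le_ofReal]; linarith)).const_mul _]
    simp [integral_const_mul, hε.mean]
  · simp_rw [abs_mul, Real.mul_rpow (abs_nonneg _) (abs_nonneg _)]
    rw [integral_const_mul, mul_comm (K ^ 2), Real.mul_rpow (sq_nonneg _) (sq_nonneg _),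
      ← sq_abs (β c)]
    have e : (|β c| ^ 2) ^ (J / 2) = |β c| ^ J := by
      rw [← Real.rpow_natCast, ← Real.rpow_mul (abs_nonneg _)]; congr 1; push_cast; ring
    rw [e]
    gcongr
    exact (hmom c).2

/-- The tail bound for one lag: `U s` depends on the innovations of the `h` periods after `s`, and
it is multiplied by a linear form in the innovations of the period `s - d`. -/
lemma IsInnovation.fukNagaev_lag {J Kε Ku : ℝ} (hJ : 2 ≤ J) (hKε : 0 < Kε) (hKu : 0 < Ku)
    {ε : ℤ → Ω → Fin N → ℝ} (hε : IsInnovation P J Kε ε) {h : ℕ} (hh : 1 ≤ h) {U : ℤ → Ω → ℝ}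
    (hUmeas : ∀ s, Measurable[timeAlgebra ε (Set.Icc (s + 1) (s + h))] (U s))
    (hUmom : ∀ s, eLpNorm (U s) (ENNReal.ofReal J) P ≤ ENNReal.ofReal Ku)
    {β : Fin N → ℝ} (hβ : 0 < ∑ c, β c ^ 2) (d : ℕ) {T : ℕ} (hT : 0 < T) {x : ℝ} (hx : 0 < x) :
    P.real {ω | ∃ t ≤ T, x ≤ |∑ s ∈ Finset.range t,
        U (1 + s) ω * ∑ c, β c * ε (1 + s - d) ω c|} ≤
      polyConst J * (T * ((h + d : ℕ) : ℝ) ^ (J / 2 - 1) *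
          (Ku ^ 2 * (momentConst J * (Kε ^ 2 * ∑ c, β c ^ 2))) ^ (J / 2) / x ^ J)
        + 32 * Real.exp (-(x ^ 2 / (expConst J *
          (T * (Ku ^ 2 * (momentConst J * (Kε ^ 2 * ∑ c, β c ^ 2))))))) := by
  have hC := momentConst_pos hJ
  set w : ℤ → Ω → ℝ := fun s ω => ∑ c, β c * ε (s - d) ω c with hw
  have hwmeas : ∀ (A : Set ℤ) (s : ℤ), s - d ∈ A → Measurable[timeAlgebra ε A] (w s) :=
    fun A s hs => Finset.measurable_fun_sum _ fun c _ =>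
      (measurable_timeAlgebra ε hs c).const_mul _
  have hle := hε.timeAlgebra_le
  have hUm : ∀ s, Measurable (U s) := fun s => (hUmeas s).mono (hle _) le_rfl
  have hUL := fun s => integral_abs_rpow_le_of_eLpNorm_le hJ hKu.le
    (hUm s).aestronglyMeasurable (hUmom s)
  have hwL := fun s : ℤ => hε.linearForm hJ hKε.le β (s - d)
  have hUw : ∀ s, IndepFun (U s) (w s) P := by
    intro s
    rw [IndepFun_iff_Indep]
    refine indep_of_indep_of_le (hε.indep_timeAlgebra (A := Set.Icc (s + 1) (s + h))
      (A' := {s - d}) ?_) (hUmeas s).comap_le (hwmeas _ s (Set.mem_singleton _)).comap_le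
    rw [Set.disjoint_singleton_right, Set.mem_Icc]
    omega
  have hprod := fun s => memLp_mul_and_integral_abs_mul_rpow_le_of_indepFun hJ (sq_nonneg Ku)
    (by positivity) (hUw s) (hUL s).1 (hwL s).1 (hUL s).2 (hwL s).2.1
  have hymeas : ∀ (A : Set ℤ) (s : ℤ), Set.Icc (s - d) (s + h) ⊆ A →
      Measurable[timeAlgebra ε A] (fun ω => U s ω * w s ω) := by
    intro A s hA
    exact ((hUmeas s).mono (timeAlgebra_mono ε ((Set.Icc_subset_Icc_left (by omega)).trans hA))
      le_rfl).mul (hwmeas A s (hA (Set.mem_Icc.2 ⟨le_rfl, by omega⟩)))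
  have hrev : IsReverseMartingaleDiff (fun s ω => U s ω * w s ω)
      (fun s => timeAlgebra ε (Set.Ici (s - d))) P := by
    refine ⟨fun s t hst => timeAlgebra_mono ε (Set.Ici_subset_Ici.2 (by omega)), fun s => hle _,
      fun s => (hymeas _ s fun t ht => ht.1).stronglyMeasurable, fun s => ?_⟩
    have hJ1 : 1 ≤ ENNReal.ofReal J := by rw [ENNReal.one_le_ofReal]; linarith
    have h1 : P[fun ω => U s ω * w s ω | timeAlgebra ε (Set.Ici (s + 1 - d))] =ᵐ[P]
        U s * P[w s | timeAlgebra ε (Set.Ici (s + 1 - d))] := by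
      refine condExp_mul_of_stronglyMeasurable_left ?_ ((hprod s).1.integrable hJ1)
        ((hwL s).1.integrable hJ1)
      refine ((hUmeas s).mono (timeAlgebra_mono ε fun t ht => ?_) le_rfl).stronglyMeasurable
      have := ht.1
      rw [Set.mem_Ici]; omega
    have h2 : P[w s | timeAlgebra ε (Set.Ici (s + 1 - d))] =ᵐ[P] fun _ => P[w s] := by
      refine condExp_indep_eq (hle {s - d}) (hle _) (hwmeas _ s (Set.mem_singleton _)).stronglyMeasurable
        (hε.indep_timeAlgebra ?_)
      rw [Set.disjoint_singleton_left, Set.mem_Ici]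
      omega
    filter_upwards [h1, h2] with ω e1 e2
    have e3 : P[w s] = 0 := (hwL s).2.2
    rw [e1, Pi.mul_apply, e2, e3]; simp
  have hdep : IsMDependent (fun s ω => U s ω * w s ω) (h + d) P := by
    intro s
    refine indep_of_indep_of_le (hε.indep_timeAlgebra (A := Set.Iio (s + h))
      (A' := Set.Ici (s + h)) ?_) (iSup₂_le fun i hi => (hymeas _ i fun t ht => ?_).comap_le)
      (iSup₂_le fun i hi => (hymeas _ i fun t ht => ?_).comap_le)
    · exact Set.disjoint_left.2 fun t h1 h2 => absurd (Set.mem_Iio.1 h1) (not_lt.2 h2)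
    · have := ht.2
      have := Set.mem_Iio.1 hi
      rw [Set.mem_Iio]; omega
    · have h1 := ht.1
      have h2 := Set.mem_Ici.1 hi
      push_cast at h2
      rw [Set.mem_Ici]; omega
  exact hrev.fukNagaev (by omega) hdep hJ (by positivity) (fun s => (hprod s).1)
    (fun s => (hprod s).2) 1 hT hx

end Innovations

/-! ### The horizon factor -/

section HorizonFactor

variable {N : ℕ} {J : ℝ} {B : ℕ → Matrix (Fin N) (Fin N) ℝ} {h : ℕ} {j : Fin N}

lemma rowNorm_nonneg (M : Matrix (Fin N) (Fin N) ℝ) (j : Fin N) : 0 ≤ rowNorm M j :=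
  Real.sqrt_nonneg _

lemma rowNorm_sq (M : Matrix (Fin N) (Fin N) ℝ) (j : Fin N) :
    rowNorm M j ^ 2 = ∑ c, M j c ^ 2 :=
  Real.sq_sqrt (Finset.sum_nonneg fun _ _ => sq_nonneg _)

lemma horizonTerm_nonneg (k : ℕ) : 0 ≤ horizonTerm J B h j k := by
  have := rowNorm_nonneg (B k) j
  unfold horizonTerm; positivity

lemma horizonTerm_eq (hJ : 4 ≤ J) (k : ℕ) : horizonTerm J B h j k =
    ((k : ℝ) + h) ^ ((J - 2) / (2 * (J + 1))) * rowNorm (B k) j ^ (J / (J + 1)) := by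
  have hr := rowNorm_nonneg (B k) j
  have hJ1 : J + 1 ≠ 0 := by linarith
  rw [horizonTerm, Real.mul_rpow (by positivity) (by positivity), ← Real.rpow_mul (by positivity),
    ← Real.rpow_mul hr]
  congr 2 <;> field_simp

lemma horizonTerm_rpow (hJ : 4 ≤ J) (k : ℕ) : horizonTerm J B h j k ^ (J + 1) =
    ((k : ℝ) + h) ^ (J / 2 - 1) * rowNorm (B k) j ^ J := by
  have hr := rowNorm_nonneg (B k) j
  rw [horizonTerm, ← Real.rpow_mul (by positivity), one_div, inv_mul_cancel₀ (by linarith),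
    Real.rpow_one]

lemma horizonTerm_le (hJ : 4 ≤ J) (hh : 1 ≤ h) (k : ℕ) : horizonTerm J B h j k ≤
    (h : ℝ) ^ ((J - 2) / (2 * (J + 1))) * (2 ^ ((J - 2) / (2 * (J + 1))) * decayTerm J B j k
      + if k = 0 then rowNorm (B 0) j ^ (J / (J + 1)) else 0) := by
  have hh' : (1 : ℝ) ≤ h := by exact_mod_cast hh
  have he : 0 ≤ (J - 2) / (2 * (J + 1)) := div_nonneg (by linarith) (by linarith)
  have hr := rowNorm_nonneg (B k) j
  rw [horizonTerm_eq hJ]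
  rcases Nat.eq_zero_or_pos k with rfl | hk
  · have h0 : 0 ≤ 2 ^ ((J - 2) / (2 * (J + 1))) * decayTerm J B j 0 := by
      unfold decayTerm; positivity
    simp only [Nat.cast_zero, zero_add, if_true]
    gcongr
    linarith
  · have hk' : (1 : ℝ) ≤ k := by exact_mod_cast hk
    rw [if_neg hk.ne', add_zero, decayTerm, ← mul_assoc, ← mul_assoc]
    gcongr
    calc ((k : ℝ) + h) ^ ((J - 2) / (2 * (J + 1)))
        ≤ (h * 2 * k) ^ ((J - 2) / (2 * (J + 1))) := by
          refine Real.rpow_le_rpow (by positivity) ?_ he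
          nlinarith
      _ = (h : ℝ) ^ ((J - 2) / (2 * (J + 1))) * 2 ^ ((J - 2) / (2 * (J + 1)))
            * (k : ℝ) ^ ((J - 2) / (2 * (J + 1))) := by
          rw [Real.mul_rpow (by positivity) (by positivity),
            Real.mul_rpow (by positivity) (by positivity)]
      _ ≤ _ := by
          gcongr
          linarith

lemma summable_horizonTerm (hJ : 4 ≤ J) (hh : 1 ≤ h) (hs : Summable (decayTerm J B j)) :
    Summable (horizonTerm J B h j) := by
  refine Summable.of_nonneg_of_le horizonTerm_nonneg (horizonTerm_le hJ hh) ?_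
  exact ((hs.mul_left _).add (hasSum_ite_eq 0 _).summable).mul_left _

lemma tsum_horizonTerm_le (hJ : 4 ≤ J) (hh : 1 ≤ h) (hs : Summable (decayTerm J B j)) :
    ∑' k, horizonTerm J B h j k ≤ (h : ℝ) ^ ((J - 2) / (2 * (J + 1))) *
      (2 ^ ((J - 2) / (2 * (J + 1))) * ∑' k, decayTerm J B j k
        + rowNorm (B 0) j ^ (J / (J + 1))) := by
  have h1 := hs.mul_left (2 ^ ((J - 2) / (2 * (J + 1))))
  have h2 := hasSum_ite_eq (0 : ℕ) (rowNorm (B 0) j ^ (J / (J + 1)))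
  refine ((summable_horizonTerm hJ hh hs).tsum_le_tsum (horizonTerm_le hJ hh)
    ((h1.add h2.summable).mul_left _)).trans_eq ?_
  rw [tsum_mul_left, h1.tsum_add h2.summable, tsum_mul_left, h2.tsum_eq]

lemma tsum_horizonTerm_le_horizonFactor (j : Fin N) :
    ∑' k, horizonTerm J B h j k ≤ horizonFactor J B h :=
  le_ciSup (f := fun j => ∑' k, horizonTerm J B h j k) (Set.finite_range _).bddAbove j

lemma exists_horizonFactor_le (hJ : 4 ≤ J) (Kβ K₀ : ℝ) : ∃ C : ℝ, 0 < C ∧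
    ∀ (N : ℕ) (B : ℕ → Matrix (Fin N) (Fin N) ℝ)
      (_ : ∀ j, Summable (decayTerm J B j) ∧ ∑' ℓ, decayTerm J B j ℓ ≤ Kβ)
      (_ : ∀ j, rowNorm (B 0) j ≤ K₀) (h : ℕ) (_ : 1 ≤ h),
      (∀ j, Summable (horizonTerm J B h j)) ∧
      horizonFactor J B h ≤ C * (h : ℝ) ^ ((J - 2) / (2 * (J + 1))) := by
  refine ⟨2 ^ ((J - 2) / (2 * (J + 1))) * |Kβ| + |K₀| ^ (J / (J + 1)) + 1, by positivity,
    fun N B hB hB0 h hh => ⟨fun j => summable_horizonTerm hJ hh (hB j).1, ?_⟩⟩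
  refine Real.iSup_le (fun j => ?_) (by positivity)
  refine (tsum_horizonTerm_le hJ hh (hB j).1).trans ?_
  rw [mul_comm]
  have h1 : ∑' k, decayTerm J B j k ≤ |Kβ| := (hB j).2.trans (le_abs_self _)
  have h2 : rowNorm (B 0) j ^ (J / (J + 1)) ≤ |K₀| ^ (J / (J + 1)) :=
    Real.rpow_le_rpow (rowNorm_nonneg _ _) ((hB0 j).trans (le_abs_self _))
      (div_nonneg (by linarith) (by linarith))
  refine mul_le_mul_of_nonneg_right ?_ (by positivity)
  have h3 : (2 : ℝ) ^ ((J - 2) / (2 * (J + 1))) * ∑' k, decayTerm J B j k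
      ≤ 2 ^ ((J - 2) / (2 * (J + 1))) * |Kβ| := by gcongr
  linarith

/-- The weights `horizonTerm` make the Gaussian exponent of the lag `k` grow with `k`, uniformly in
the horizon. -/
lemma rowNorm_sq_mul_sqrt_le (hJ : 4 ≤ J) (hh : 1 ≤ h) {μ : ℝ} {k : ℕ}
    (hμ : horizonTerm J B h j k ≤ μ) :
    rowNorm (B k) j ^ 2 * Real.sqrt (k + 1) ≤ horizonTerm J B h j k ^ 2 * μ ^ (2 / J) := by
  have hr := rowNorm_nonneg (B k) j
  have ha : 0 ≤ horizonTerm J B h j k := horizonTerm_nonneg k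
  have hJ0 : 0 < J := by linarith
  have hh' : (1 : ℝ) ≤ h := by exact_mod_cast hh
  have e : horizonTerm J B h j k ^ 2 * horizonTerm J B h j k ^ (2 / J)
      = rowNorm (B k) j ^ 2 * ((k : ℝ) + h) ^ (1 - 2 / J) := by
    have h1 := congrArg (fun z : ℝ => z ^ (2 / J)) (horizonTerm_rpow (B := B) (h := h) (j := j) hJ k)
    rw [← Real.rpow_mul ha, Real.mul_rpow (by positivity) (by positivity),
      ← Real.rpow_mul (by positivity), ← Real.rpow_mul hr] at h1
    rw [show (J + 1) * (2 / J) = 2 + 2 / J by field_simp,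
      show J * (2 / J) = 2 by field_simp, show (J / 2 - 1) * (2 / J) = 1 - 2 / J by field_simp,
      Real.rpow_add_of_nonneg ha (by norm_num) (by positivity), Real.rpow_two, Real.rpow_two] at h1
    rw [h1]; ring
  calc rowNorm (B k) j ^ 2 * Real.sqrt (k + 1)
      ≤ rowNorm (B k) j ^ 2 * ((k : ℝ) + h) ^ (1 - 2 / J) := by
        gcongr
        rw [Real.sqrt_eq_rpow]
        calc ((k : ℝ) + 1) ^ (1 / 2 : ℝ) ≤ ((k : ℝ) + h) ^ (1 / 2 : ℝ) := by gcongr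
          _ ≤ ((k : ℝ) + h) ^ (1 - 2 / J) := by
            refine Real.rpow_le_rpow_of_exponent_le (by linarith [Nat.cast_nonneg (α := ℝ) k]) ?_
            have : 2 / J ≤ 1 / 2 := by rw [div_le_div_iff₀ hJ0 (by norm_num)]; linarith
            linarith
    _ = horizonTerm J B h j k ^ 2 * horizonTerm J B h j k ^ (2 / J) := e.symm
    _ ≤ _ := by gcongr

end HorizonFactor

lemma exp_neg_sqrt_le (k : ℕ) : Real.exp (-Real.sqrt (k + 1)) ≤ 24 / ((k : ℝ) + 1) ^ 2 := by
  have h := Real.pow_div_factorial_le_exp (Real.sqrt (k + 1)) (Real.sqrt_nonneg _) 4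
  have e : Real.sqrt ((k : ℝ) + 1) ^ 4 = ((k : ℝ) + 1) ^ 2 := by
    rw [show 4 = 2 * 2 by norm_num, pow_mul, Real.sq_sqrt (by positivity)]
  rw [e] at h
  rw [Real.exp_neg, ← one_div, div_le_div_iff₀ (Real.exp_pos _) (by positivity)]
  have h4 : ((Nat.factorial 4 : ℕ) : ℝ) = 24 := by norm_num [Nat.factorial]
  rw [h4, div_le_iff₀ (by norm_num)] at h
  linarith

lemma measureReal_iUnion_le_tsum {Ω : Type*} {mΩ : MeasurableSpace Ω} {P : Measure Ω}
    [IsProbabilityMeasure P] {E : ℕ → Set Ω} {b : ℕ → ℝ} (hb : Summable b)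
    (h : ∀ k, P.real (E k) ≤ b k) : P.real (⋃ k, E k) ≤ ∑' k, b k := by
  have hb0 : ∀ k, 0 ≤ b k := fun k => measureReal_nonneg.trans (h k)
  have h1 : P (⋃ k, E k) ≤ ENNReal.ofReal (∑' k, b k) := by
    rw [ENNReal.ofReal_tsum_of_nonneg hb0 hb]
    refine (measure_iUnion_le E).trans (ENNReal.tsum_le_tsum fun k => ?_)
    rw [← ofReal_measureReal]
    exact ENNReal.ofReal_le_ofReal (h k)
  exact ENNReal.toReal_le_of_le_ofReal (tsum_nonneg hb0) h1

/-! ### Summation over the lags -/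

section Concentration

variable {J : ℝ}

/-- The threshold `a_k δ / (2 μ)` for lag `k`, with `a_k` the `k`-th term of the series defining the
horizon factor, turns the bound for one lag into a multiple of `a_k`, plus a Gaussian term that is
summable over `k`. Here `L ‖β_k‖²` is the variance proxy of the lag and `m` its dependence range. -/
lemma lag_bound_le {N : ℕ} {B : ℕ → Matrix (Fin N) (Fin N) ℝ} {h : ℕ} {j : Fin N}
    (hJ : 4 ≤ J) (hh : 1 ≤ h) {p ℓ k : ℕ} (hℓ : ℓ < p) {L μ T δ : ℝ} (hL : 0 < L) (hT : 0 < T)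
    (hδ : 0 < δ) (hβ : 0 < rowNorm (B k) j) (hμk : horizonTerm J B h j k ≤ μ)
    (hδc : Real.sqrt (8 * (expConst J * L)) * Real.sqrt T * μ ^ (1 + 1 / J) < δ) :
    polyConst J * (T * ((h + (ℓ + k) : ℕ) : ℝ) ^ (J / 2 - 1)
          * (L * rowNorm (B k) j ^ 2) ^ (J / 2) / (horizonTerm J B h j k * δ / (2 * μ)) ^ J)
        + 32 * Real.exp (-((horizonTerm J B h j k * δ / (2 * μ)) ^ 2
          / (expConst J * (T * (L * rowNorm (B k) j ^ 2)))))
      ≤ polyConst J * ((p : ℝ) + 1) ^ (J / 2 - 1) * L ^ (J / 2) * 2 ^ J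
          * (T / δ ^ J) * μ ^ J * horizonTerm J B h j k
        + 768 * Real.exp (-(1 / (8 * (expConst J * L)) * δ ^ 2 / (T * μ ^ (2 + 2 / J))))
          * (1 / ((k : ℝ) + 1) ^ 2) := by
  have hJ0 : 0 < J := by linarith
  have hE := expConst_pos (show 2 ≤ J by linarith)
  have hP := polyConst_pos (show 2 ≤ J by linarith)
  set r := rowNorm (B k) j with hr
  set a := horizonTerm J B h j k with ha
  have hkh : (1 : ℝ) ≤ (k : ℝ) + h := by
    have : (1 : ℝ) ≤ h := by exact_mod_cast hh
    linarith [Nat.cast_nonneg (α := ℝ) k]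
  have ha0 : 0 < a := by
    rw [ha, horizonTerm]
    have : 0 < (k : ℝ) + h := by linarith
    positivity
  have hμ : 0 < μ := ha0.trans_le hμk
  refine add_le_add ?_ ?_
  · have hm : ((h + (ℓ + k) : ℕ) : ℝ) ≤ ((p : ℝ) + 1) * ((k : ℝ) + h) := by
      have : (ℓ : ℝ) ≤ p := by exact_mod_cast hℓ.le
      have hp0 : (0 : ℝ) ≤ p := Nat.cast_nonneg p
      push_cast
      nlinarith
    have hm2 : ((h + (ℓ + k) : ℕ) : ℝ) ^ (J / 2 - 1) ≤
        ((p : ℝ) + 1) ^ (J / 2 - 1) * ((k : ℝ) + h) ^ (J / 2 - 1) := by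
      rw [← Real.mul_rpow (by positivity) (by linarith)]
      exact Real.rpow_le_rpow (by positivity) hm (by linarith)
    have e1 : (L * r ^ 2) ^ (J / 2) = L ^ (J / 2) * r ^ J := by
      rw [Real.mul_rpow hL.le (by positivity), ← Real.rpow_natCast r 2, ← Real.rpow_mul hβ.le]
      congr 2; push_cast; ring
    have e2 : (a * δ / (2 * μ)) ^ J = a ^ J * δ ^ J / (2 ^ J * μ ^ J) := by
      rw [Real.div_rpow (by positivity) (by positivity), Real.mul_rpow ha0.le hδ.le,
        Real.mul_rpow (by norm_num) hμ.le]
    have e3 : ((k : ℝ) + h) ^ (J / 2 - 1) * r ^ J = a ^ J * a := by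
      rw [← Real.rpow_add_one ha0.ne']; exact (horizonTerm_rpow hJ k).symm
    rw [e1, e2]
    calc polyConst J * (T * ((h + (ℓ + k) : ℕ) : ℝ) ^ (J / 2 - 1) * (L ^ (J / 2) * r ^ J)
          / (a ^ J * δ ^ J / (2 ^ J * μ ^ J)))
        ≤ polyConst J * (T * (((p : ℝ) + 1) ^ (J / 2 - 1) * ((k : ℝ) + h) ^ (J / 2 - 1))
          * (L ^ (J / 2) * r ^ J) / (a ^ J * δ ^ J / (2 ^ J * μ ^ J))) := by gcongr
      _ = polyConst J * (T * ((p : ℝ) + 1) ^ (J / 2 - 1) * L ^ (J / 2)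
          * (((k : ℝ) + h) ^ (J / 2 - 1) * r ^ J) / (a ^ J * δ ^ J / (2 ^ J * μ ^ J))) := by ring
      _ = _ := by
          rw [e3]
          have : a ^ J ≠ 0 := by positivity
          field_simp
  · set c := 1 / (8 * (expConst J * L)) with hc
    have hc0 : 0 < c := by positivity
    set D := δ ^ 2 / (T * μ ^ (2 + 2 / J)) with hD
    have hμe : μ ^ (2 + 2 / J) = μ ^ 2 * μ ^ (2 / J) := by
      rw [Real.rpow_add hμ, Real.rpow_two]
    have hcD : 1 ≤ c * D := by
      have h1 := pow_le_pow_left₀ (by positivity) hδc.le 2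
      rw [mul_pow, mul_pow, Real.sq_sqrt (by positivity), Real.sq_sqrt hT.le,
        ← Real.rpow_natCast (μ ^ _), ← Real.rpow_mul hμ.le,
        show (1 + 1 / J) * ((2 : ℕ) : ℝ) = 2 + 2 / J by push_cast; ring] at h1
      rw [hc, hD, div_mul_div_comm, le_div_iff₀ (by positivity)]
      linarith
    have hkey : 2 * (c * D) * Real.sqrt (k + 1) ≤
        (a * δ / (2 * μ)) ^ 2 / (expConst J * (T * (L * r ^ 2))) := by
      have h1 := rowNorm_sq_mul_sqrt_le hJ hh hμk
      rw [le_div_iff₀ (by positivity)]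
      have e : 2 * (c * D) * Real.sqrt (k + 1) * (expConst J * (T * (L * r ^ 2)))
          = δ ^ 2 / (4 * μ ^ 2 * μ ^ (2 / J)) * (r ^ 2 * Real.sqrt (k + 1)) := by
        rw [hc, hD, hμe]; field_simp; norm_num
      rw [e]
      calc δ ^ 2 / (4 * μ ^ 2 * μ ^ (2 / J)) * (r ^ 2 * Real.sqrt (k + 1))
          ≤ δ ^ 2 / (4 * μ ^ 2 * μ ^ (2 / J)) * (a ^ 2 * μ ^ (2 / J)) := by gcongr
        _ = (a * δ / (2 * μ)) ^ 2 := by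
            have : μ ^ (2 / J) ≠ 0 := by positivity
            field_simp; norm_num
    have hs1 : 1 ≤ Real.sqrt (k + 1) := by
      rw [Real.one_le_sqrt]; linarith [Nat.cast_nonneg (α := ℝ) k]
    have hexp : -((a * δ / (2 * μ)) ^ 2 / (expConst J * (T * (L * r ^ 2)))) ≤
        -(c * δ ^ 2 / (T * μ ^ (2 + 2 / J))) + -Real.sqrt (k + 1) := by
      rw [mul_div_assoc c, ← hD]
      nlinarith
    calc 32 * Real.exp (-((a * δ / (2 * μ)) ^ 2 / (expConst J * (T * (L * r ^ 2)))))
        ≤ 32 * (Real.exp (-(c * δ ^ 2 / (T * μ ^ (2 + 2 / J)))) * (24 / ((k : ℝ) + 1) ^ 2)) := by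
          refine mul_le_mul_of_nonneg_left ?_ (by norm_num)
          refine (Real.exp_le_exp.2 hexp).trans ?_
          rw [Real.exp_add]
          gcongr
          exact exp_neg_sqrt_le k
      _ = _ := by ring

lemma IsInnovation.mono {Ω : Type*} [MeasurableSpace Ω] {P : Measure Ω} {N : ℕ} {K K' : ℝ}
    {ε : ℤ → Ω → Fin N → ℝ} (hε : IsInnovation P J K ε) (h : K ≤ K') : IsInnovation P J K' ε :=
  { hε with moment := fun i t => (hε.moment i t).trans (ENNReal.ofReal_le_ofReal h) }

lemma measurable_of_forall_apply {Ω : Type*} {m : MeasurableSpace Ω} {h N : ℕ}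
    {f : Ω → Fin h → Fin N → ℝ} (hf : ∀ k c, Measurable fun ω => f ω k c) : Measurable f :=
  measurable_pi_lambda _ fun k => measurable_pi_lambda _ fun c => hf k c

lemma summable_one_div_succ_sq : Summable fun k : ℕ => 1 / ((k : ℝ) + 1) ^ 2 := by
  have h := (summable_nat_add_iff 1).2 (Real.summable_one_div_nat_pow.2 (one_lt_two))
  simpa using h

lemma exists_concentration_constants (hJ : 4 ≤ J) (p : ℕ) (Kε Ku : ℝ) :
    ∃ c₁ c₂ c₃ c₄ : ℝ, 0 < c₁ ∧ 0 < c₂ ∧ 0 < c₃ ∧ 0 < c₄ ∧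
      ∀ (Ω : Type*) [MeasurableSpace Ω] (P : Measure Ω) [IsProbabilityMeasure P]
        (N T h : ℕ) (_ : 1 ≤ h) (_ : h < T)
        (B : ℕ → Matrix (Fin N) (Fin N) ℝ) (ε x u : ℤ → Ω → Fin N → ℝ)
        (_ : IsInnovation P J Kε ε)
        (_ : IsMovingAverage P B ε x)
        (_ : IsForecastError P J Ku p h ε x u)
        (_ : ∀ j, Summable (decayTerm J B j))
        (i j : Fin N) (ℓ : ℕ) (_ : ℓ < p) (δ : ℝ)
        (_ : c₄ * Real.sqrt T * horizonFactor J B h ^ (1 + 1 / J) < δ),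
        P.real {ω | ∃ t ∈ Finset.Icc 1 (T - h),
            δ ≤ |∑ s ∈ Finset.Icc 1 t, u (s : ℤ) ω i * x ((s : ℤ) - (ℓ : ℤ)) ω j|}
          ≤ c₁ * ((T : ℝ) / δ ^ J) * horizonFactor J B h ^ (J + 1)
            + c₂ * Real.exp (-(c₃ * δ ^ 2 / ((T : ℝ) * horizonFactor J B h ^ (2 + 2 / J)))) := by
  have hJ2 : 2 ≤ J := by linarith
  have hE := expConst_pos hJ2
  have hP := polyConst_pos hJ2
  have hC := momentConst_pos hJ2
  -- enlarging the moment bounds makes them positive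
  set K₁ := max Kε 1 with hK₁
  set K₂ := max Ku 1 with hK₂
  have hK₁0 : 0 < K₁ := lt_max_of_lt_right one_pos
  have hK₂0 : 0 < K₂ := lt_max_of_lt_right one_pos
  set L := K₂ ^ 2 * momentConst J * K₁ ^ 2 with hL
  have hL0 : 0 < L := by positivity
  have hsum := summable_one_div_succ_sq
  refine ⟨polyConst J * ((p : ℝ) + 1) ^ (J / 2 - 1) * L ^ (J / 2) * 2 ^ J,
    768 * ∑' k : ℕ, 1 / ((k : ℝ) + 1) ^ 2, 1 / (8 * (expConst J * L)),
    Real.sqrt (8 * (expConst J * L)), by positivity,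
    mul_pos (by norm_num) (hsum.tsum_pos (fun k => by positivity) 0 (by norm_num)),
    by positivity, by positivity, ?_⟩
  intro Ω _ P _ N T h hh hhT B ε x u hε hx hu hB i j ℓ hℓ δ hδc
  have hT : 0 < T := by omega
  have hT' : (0 : ℝ) < T := by exact_mod_cast hT
  set μ := horizonFactor J B h with hμdef
  have hsj := summable_horizonTerm hJ hh (hB j)
  have hμj : ∑' k, horizonTerm J B h j k ≤ μ := tsum_horizonTerm_le_horizonFactor j
  have hμ0 : 0 ≤ μ := (tsum_nonneg fun k => horizonTerm_nonneg k).trans hμj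
  have hμk : ∀ k, horizonTerm J B h j k ≤ μ := fun k =>
    (hsj.le_tsum k fun k _ => horizonTerm_nonneg k).trans hμj
  have hδ : 0 < δ := lt_of_le_of_lt (by positivity) hδc
  replace hε := hε.mono (le_max_left Kε 1)
  obtain ⟨g, hg, hgu⟩ := hu.future
  set U : ℤ → Ω → ℝ := fun s ω => g (fun k : Fin h => ε (s + h - (k : ℕ)) ω) i with hU
  have hUmeas : ∀ s, Measurable[timeAlgebra ε (Set.Icc (s + 1) (s + h))] (U s) := by
    intro s
    have h1 : Measurable[timeAlgebra ε (Set.Icc (s + 1) (s + h))]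
        (fun ω (k : Fin h) => ε (s + h - (k : ℕ)) ω) := by
      refine measurable_of_forall_apply fun k c => measurable_timeAlgebra ε ?_ c
      have := k.2
      rw [Set.mem_Icc]; omega
    exact (measurable_pi_apply i).comp (hg.comp h1)
  have hUmom : ∀ s, eLpNorm (U s) (ENNReal.ofReal J) P ≤ ENNReal.ofReal K₂ := by
    intro s
    rw [eLpNorm_congr_ae (g := fun ω => u s ω i) ((hgu s).mono fun ω hω => (congrFun hω i).symm)]
    exact (hu.moment i s).trans (ENNReal.ofReal_le_ofReal (le_max_left _ _))
  set y : ℕ → ℕ → Ω → ℝ := fun k s ω =>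
    U (1 + s) ω * ∑ c, B k j c * ε (1 + s - ((ℓ + k : ℕ) : ℤ)) ω c with hy
  -- the event splits over the lags with a nonzero row
  set E : ℕ → Set Ω := fun k => {ω | 0 < rowNorm (B k) j ∧ ∃ t ≤ T,
    horizonTerm J B h j k * δ / (2 * μ) ≤ |∑ s ∈ Finset.range t, y k s ω|} with hEdef
  have hzero : ∀ k, rowNorm (B k) j = 0 → ∀ s ω, y k s ω = 0 := by
    intro k hk s ω
    have h1 : ∑ c, B k j c ^ 2 = 0 := by rw [← rowNorm_sq, hk]; norm_num
    have h2 := (Finset.sum_eq_zero_iff_of_nonneg fun c _ => sq_nonneg (B k j c)).1 h1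
    have h3 : ∀ c, B k j c = 0 := fun c => by simpa using h2 c (Finset.mem_univ c)
    simp [hy, h3]
  have hsub : {ω | ∃ t ∈ Finset.Icc 1 (T - h),
      δ ≤ |∑ s ∈ Finset.Icc 1 t, u (s : ℤ) ω i * x ((s : ℤ) - (ℓ : ℤ)) ω j|}
      ≤ᵐ[P] ⋃ k, E k := by
    filter_upwards [ae_all_iff.2 hgu, ae_all_iff.2 hx] with ω h1 h2
    rintro ⟨t, ht, hω⟩
    by_contra hcon
    have hcon' : ω ∉ ⋃ k, E k := hcon
    simp only [hEdef, Set.mem_iUnion, Set.mem_ofPred_eq, not_exists, not_and, not_le] at hcon'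
    have htT : t ≤ T := by have := (Finset.mem_Icc.1 ht).2; omega
    have hS : HasSum (fun k => ∑ s ∈ Finset.range t, y k s ω)
        (∑ s ∈ Finset.Icc 1 t, u (s : ℤ) ω i * x ((s : ℤ) - (ℓ : ℤ)) ω j) := by
      have e : ∑ s ∈ Finset.Icc 1 t, u (s : ℤ) ω i * x ((s : ℤ) - (ℓ : ℤ)) ω j
          = ∑ s ∈ Finset.range t, U (1 + s) ω * x (1 + s - ℓ) ω j := by
        have e0 := Finset.sum_Ico_add' (fun s : ℕ => u (s : ℤ) ω i * x ((s : ℤ) - (ℓ : ℤ)) ω j) 0 t 1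
        rw [show Finset.Icc 1 t = Finset.Ico (0 + 1) (t + 1) by ext; simp, ← e0,
          ← Finset.range_eq_Ico]
        refine Finset.sum_congr rfl fun s _ => ?_
        rw [h1, Nat.cast_add, Nat.cast_one, add_comm (s : ℤ) 1]
      rw [e]
      refine hasSum_sum fun s _ => HasSum.mul_left _ ?_
      have h3 := Pi.hasSum.1 (h2 (1 + s - ℓ)) j
      refine h3.congr_fun ?_
      intro k
      simp only [Matrix.mulVec, dotProduct]
      refine Finset.sum_congr rfl fun c _ => ?_
      rw [Nat.cast_add, sub_sub]
    have hle : ∀ k, |∑ s ∈ Finset.range t, y k s ω| ≤ horizonTerm J B h j k * (δ / (2 * μ)) := by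
      intro k
      rcases (rowNorm_nonneg (B k) j).eq_or_lt with hk | hk
      · simp only [hzero k hk.symm, Finset.sum_const_zero, abs_zero]
        exact mul_nonneg (horizonTerm_nonneg k) (by positivity)
      · rw [← mul_div_assoc]
        exact (hcon' k hk t htT).le
    have hbd := tsum_of_norm_bounded (f := fun k => ∑ s ∈ Finset.range t, y k s ω) (hsj.hasSum.mul_right (δ / (2 * μ))) hle
    rw [hS.tsum_eq, Real.norm_eq_abs] at hbd
    have hfin : (∑' k, horizonTerm J B h j k) * (δ / (2 * μ)) ≤ δ / 2 := by
      -- if `μ = 0`, all lags vanish and the junk value `δ / (2 * 0) = 0` is the right threshold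
      rcases hμ0.eq_or_lt with h0 | h0
      · rw [← h0]; simp; positivity
      · calc (∑' k, horizonTerm J B h j k) * (δ / (2 * μ)) ≤ μ * (δ / (2 * μ)) := by gcongr
          _ = δ / 2 := by field_simp
    linarith
  set D := Real.exp (-(1 / (8 * (expConst J * L)) * δ ^ 2 / (T * μ ^ (2 + 2 / J)))) with hD
  set b : ℕ → ℝ := fun k => polyConst J * ((p : ℝ) + 1) ^ (J / 2 - 1) * L ^ (J / 2) * 2 ^ J
          * (T / δ ^ J) * μ ^ J * horizonTerm J B h j k + 768 * D * (1 / ((k : ℝ) + 1) ^ 2) with hb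
  have hEb : ∀ k, P.real (E k) ≤ b k := by
    intro k
    rcases (rowNorm_nonneg (B k) j).eq_or_lt with hk | hk
    · have : E k = ∅ := by
        ext ω; simp [hEdef, ← hk]
      rw [this, measureReal_empty]
      have := horizonTerm_nonneg (J := J) (B := B) (h := h) (j := j) k
      positivity
    · have ha0 : 0 < horizonTerm J B h j k := by
        have hh' : (0 : ℝ) < h := by exact_mod_cast hh
        rw [horizonTerm]; positivity
      have hμpos : 0 < μ := ha0.trans_le (hμk k)
      have h1 := hε.fukNagaev_lag hJ2 hK₁0 hK₂0 hh hUmeas hUmom (β := fun c => B k j c)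
        (by rw [← rowNorm_sq]; positivity) (ℓ + k) hT
        (x := horizonTerm J B h j k * δ / (2 * μ)) (by positivity)
      rw [← rowNorm_sq, show K₂ ^ 2 * (momentConst J * (K₁ ^ 2 * rowNorm (B k) j ^ 2))
        = L * rowNorm (B k) j ^ 2 by rw [hL]; ring] at h1
      refine le_trans (measureReal_mono (fun ω hω => hω.2) (measure_ne_top _ _)) (h1.trans ?_)
      exact lag_bound_le hJ hh hℓ hL0 hT' hδ hk (hμk k) hδc
  have hs1 := hsj.mul_left (polyConst J * ((p : ℝ) + 1) ^ (J / 2 - 1) * L ^ (J / 2) * 2 ^ J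
    * (T / δ ^ J) * μ ^ J)
  have hs2 := hsum.mul_left (768 * D)
  have hfinal := (ENNReal.toReal_mono (measure_ne_top P _) (measure_mono_ae hsub)).trans
    (measureReal_iUnion_le_tsum (hs1.add hs2) hEb)
  refine hfinal.trans ?_
  rw [hs1.tsum_add hs2, tsum_mul_left, tsum_mul_left, Real.rpow_add_of_nonneg hμ0 (by linarith)
    zero_le_one, Real.rpow_one]
  refine add_le_add ?_ (le_of_eq (by ring))
  rw [← mul_assoc]
  exact mul_le_mul_of_nonneg_left hμj (by positivity)

end Concentration

theorem theorem1 (J : ℝ) (hJ : 4 ≤ J) (p : ℕ) (hp : 1 ≤ p) (Kε Ku : ℝ) :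
    -- the concentration inequality; the constants depend on `J`, `p`, `Kε`, `Ku` only
    (∃ c₁ c₂ c₃ c₄ : ℝ, 0 < c₁ ∧ 0 < c₂ ∧ 0 < c₃ ∧ 0 < c₄ ∧
      ∀ (Ω : Type*) [MeasurableSpace Ω] (P : Measure Ω) [IsProbabilityMeasure P]
        (N T h : ℕ) (_ : 1 ≤ h) (_ : h < T)
        (B : ℕ → Matrix (Fin N) (Fin N) ℝ) (ε x u : ℤ → Ω → Fin N → ℝ)
        (_ : IsInnovation P J Kε ε)
        (_ : IsMovingAverage P B ε x)
        (_ : IsForecastError P J Ku p h ε x u)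
        (_ : ∀ j, Summable (decayTerm J B j))
        (i j : Fin N) (ℓ : ℕ) (_ : ℓ < p) (δ : ℝ)
        (_ : c₄ * Real.sqrt T * horizonFactor J B h ^ (1 + 1 / J) < δ),
        P.real {ω | ∃ t ∈ Finset.Icc 1 (T - h),
            δ ≤ |∑ s ∈ Finset.Icc 1 t, u (s : ℤ) ω i * x ((s : ℤ) - (ℓ : ℤ)) ω j|}
          ≤ c₁ * ((T : ℝ) / δ ^ J) * horizonFactor J B h ^ (J + 1)
            + c₂ * Real.exp (-(c₃ * δ ^ 2 / ((T : ℝ) * horizonFactor J B h ^ (2 + 2 / J))))) ∧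
    -- the series defining the horizon factor converge, and the factor is `O(h^{(J-2)/(2(J+1))})`
    (∀ Kβ K₀ : ℝ, ∃ C : ℝ, 0 < C ∧
      ∀ (N : ℕ) (B : ℕ → Matrix (Fin N) (Fin N) ℝ)
        (_ : ∀ j, Summable (decayTerm J B j) ∧ ∑' ℓ, decayTerm J B j ℓ ≤ Kβ)
        (_ : ∀ j, rowNorm (B 0) j ≤ K₀) (h : ℕ) (_ : 1 ≤ h),
        (∀ j, Summable (horizonTerm J B h j)) ∧
        horizonFactor J B h ≤ C * (h : ℝ) ^ ((J - 2) / (2 * (J + 1)))) :=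
  ⟨exists_concentration_constants hJ p Kε Ku, exists_horizonFactor_le hJ⟩
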